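/- **Theorem 1.1.** Let $r,n,k$ be integers with $r\ge 3$ and $1\le k<n$. Let $K=\{0,1,\dots,r-1\}$, let $S$ be the set of vectors $x\in K^n$ with exactly $k$ nonzero entries, and let $$\mathcal D=\{(i,j)\in\mathbb N^2 : i+j\le k,\ j\le \min(k,n-k)\}.$$ For $x,y\in S$ put $e(x,y)=|\{l : x_l=y_l\ne 0\}|$, $c(x,y)=|\{l : x_l\neq 0,\ y_l\ne 0\}|$, and let $\mathcal R(x,y)=(i,j)\in\mathcal D$ be given by $e(x,y)=k-i-j$, $c(x,y)=k-j$. Then $J_r(n,k)=(S,\mathcal R)$, the nonbinary Johnson scheme, is a bivariate $Q$-polynomial association scheme on the domain $\mathcal D$ with respect to the graded lexicographic order $\le$ on $\mathbb N^2$ (where $(a,b)\le(a',b')$ if $a+b<a'+b'$, or $a+b=a'+b'$ and $a\le a'$). That is, with $\epsilon_1=(1,0)$, $\epsilon_2=(0,1)$: 1. $(S,\mathcal R)$ is a commutative association scheme: the map $\mathcal R:S\times S\to\mathcal D$ is onto, and its adjacency matrices $A_\alpha$ ($\alpha\in\mathcal D$), defined by $(A_\alpha)_{xy}=1$ if $\mathcal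 R(x,y)=\alpha$ and $0$ otherwise, commute with one another, the identity is one of them, the transpose of each is one of them, and the product of any two is a linear combination of them; 2. $\epsilon_1,\epsilon_2\in\mathcal D$, and if $(n_1,n_2)\in\mathcal D$ and $0\le m_i\le n_i$ for $i=1,2$, then $(m_1,m_2)\in\mathcal D$; 3. the primitive idempotents of the Bose–Mesner algebra $\operatorname{Span}_{\mathbb C}\{A_\alpha\}$ can be labelled bijectively as $\{E_\alpha\}_{\alpha\in\mathcal D}$ so that - for each $\alpha\in\mathcal D$ there is a polynomial $v^*_\alpha\in\mathbb C[x_1,x_2]$ of multidegree $\alpha$ with respect to $\le$, all of whose monomials $x_1^{m_1}x_2^{m_2}$ satisfy $(m_1,m_2)\in\mathcal D$, such that $|S|E_\alpha=v^*_\alpha(|S|E_{\epsilon_1},|S|E_{\epsilon_2})$ under the entrywise (Hadamard) product $\circ$; - for $i=1,2$ and each $\alpha=(n_1,n_2)\in\mathcal D$, the matrix $E_{\epsilon_i}\circ E_{\epsilon_1}^{\circ n_1}\circ E_{\epsilon_2}^{\circ n_2}$ is a linear combination of the matrices $E_{\epsilon_1}^{\circ m_1}\circ E_{\epsilon_2}^{\circ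 m_2}$ with $(m_1,m_2)\in\mathcal D$ and $(m_1,m_2)\le\alpha+\epsilon_i$. -/

import Mathlib

/-! ### Commutative association schemes -/

/-- The adjacency matrix `A_i` of the class `i` of a relation map `R : X × X → I`. -/
def adjacencyMatrix {X I : Type*} [DecidableEq I] (R : X → X → I) (i : I) : Matrix X X ℂ :=
  Matrix.of fun x y => if R x y = i then 1 else 0

/-- The linear span of the adjacency matrices. For a commutative association scheme this is the
Bose-Mesner algebra. -/
def boseMesner {X I : Type*} [DecidableEq I] (R : X → X → I) : Submodule ℂ (Matrix X X ℂ) :=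
  Submodule.span ℂ (Set.range (adjacencyMatrix R))

/-- `(X, R)` is a commutative association scheme with classes indexed by `I`. The index set `I` is
automatically finite, because `R` is onto, so `mul_mem` says that there are numbers `p^k_{ij}` with
`A_i A_j = ∑_k p^k_{ij} A_k`. -/
structure IsCommAssocScheme {X I : Type*} [Fintype X] [DecidableEq X] [DecidableEq I]
    (R : X → X → I) : Prop where
  surjective : ∀ i, ∃ x y, R x y = i
  exists_eq_one : ∃ i₀, adjacencyMatrix R i₀ = 1
  exists_transpose : ∀ i, ∃ i', (adjacencyMatrix R i).transpose = adjacencyMatrix R i'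
  mul_mem : ∀ i j, adjacencyMatrix R i * adjacencyMatrix R j ∈ boseMesner R
  mul_comm : ∀ i j, adjacencyMatrix R i * adjacencyMatrix R j =
    adjacencyMatrix R j * adjacencyMatrix R i

/-- `E` is a primitive idempotent of `𝔄` (under matrix multiplication): a nonzero idempotent of
`𝔄` that is minimal among the nonzero idempotents of `𝔄`. -/
structure IsPrimitiveIdempotent {X : Type*} [Fintype X] (𝔄 : Submodule ℂ (Matrix X X ℂ))
    (E : Matrix X X ℂ) : Prop where
  mem : E ∈ 𝔄
  ne_zero : E ≠ 0
  idem : E * E = E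
  minimal : ∀ F ∈ 𝔄, F * F = F → E * F = F → F * E = F → F = 0 ∨ F = E

/-! ### Multivariate `Q`-polynomial association schemes -/

/-- The value `p(M_1, …, M_ℓ)` of a polynomial at matrices under the Hadamard (entrywise) product;
a constant polynomial `c` has the value `c J`, where `J` is the all-one matrix. -/
noncomputable def hadamardEval {X : Type*} {l : ℕ} (M : Fin l → Matrix X X ℂ)
    (p : MvPolynomial (Fin l) ℂ) : Matrix X X ℂ :=
  Matrix.of fun x y => MvPolynomial.eval (fun i => M i x y) p

/-- The Hadamard monomial `M_1^{∘ α_1} ∘ ⋯ ∘ M_ℓ^{∘ α_ℓ}`. -/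
def hadamardMonomial {X : Type*} {l : ℕ} (M : Fin l → Matrix X X ℂ) (α : Fin l →₀ ℕ) :
    Matrix X X ℂ :=
  Matrix.of fun x y => ∏ i, M i x y ^ α i

/-- The unit vector `ε_i` of `ℕ^ℓ`. -/
noncomputable def unitIndex {l : ℕ} (i : Fin l) : Fin l →₀ ℕ := Finsupp.single i 1

/-- `(X, R)` is an `ℓ`-variate `Q`-polynomial association scheme on the domain `D ⊆ ℕ^ℓ` with
respect to the monomial order `m`. The labelling `E` of the primitive idempotents of the
Bose-Mesner algebra by `D` is the same one in the last two conditions; the values of `E` outside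
`D` play no role. -/
structure IsQPolynomialScheme {X I : Type*} [Fintype X] [DecidableEq X] [DecidableEq I] {l : ℕ}
    (R : X → X → I) (D : Set (Fin l →₀ ℕ)) (m : MonomialOrder (Fin l)) : Prop where
  isCommAssocScheme : IsCommAssocScheme R
  unitIndex_mem : ∀ i, unitIndex i ∈ D
  mem_of_le : ∀ α ∈ D, ∀ β : Fin l →₀ ℕ, (∀ i, β i ≤ α i) → β ∈ D
  exists_labelling : ∃ E : (Fin l →₀ ℕ) → Matrix X X ℂ,
    Set.BijOn E D {F | IsPrimitiveIdempotent (boseMesner R) F} ∧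
    (∀ α ∈ D, ∃ v : MvPolynomial (Fin l) ℂ,
      v ≠ 0 ∧ m.degree v = α ∧ (∀ β ∈ v.support, β ∈ D) ∧
      (Fintype.card X : ℂ) • E α =
        hadamardEval (fun i => (Fintype.card X : ℂ) • E (unitIndex i)) v) ∧
    (∀ i, ∀ α ∈ D,
      Matrix.hadamard (E (unitIndex i)) (hadamardMonomial (fun j => E (unitIndex j)) α) ∈
        Submodule.span ℂ {M | ∃ β ∈ D, m.toSyn β ≤ m.toSyn (α + unitIndex i) ∧
          M = hadamardMonomial (fun j => E (unitIndex j)) β})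

/-! ### Nonbinary Johnson schemes -/

/-- The set `{i | x_i ≠ 0}` of nonzero positions of a vector over `K = {0, 1, …, r - 1}`. -/
def nonzeroPositions {n r : ℕ} (x : Fin n → Fin r) : Finset (Fin n) :=
  Finset.univ.filter fun i => (x i : ℕ) ≠ 0

/-- The vectors in `K^n`, `K = {0, 1, …, r - 1}`, with exactly `k` nonzero entries. -/
abbrev NonbinaryJohnsonPoint (r n k : ℕ) : Type :=
  {x : Fin n → Fin r // (nonzeroPositions x).card = k}

/-- The number `e(x, y)` of equal nonzero entries. -/
def equalNonzero {n r : ℕ} (x y : Fin n → Fin r) : ℕ :=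
  (Finset.univ.filter fun i => x i = y i ∧ (x i : ℕ) ≠ 0).card

/-- The number `c(x, y)` of common nonzero entries. -/
def commonNonzero {n r : ℕ} (x y : Fin n → Fin r) : ℕ :=
  (Finset.univ.filter fun i => (x i : ℕ) ≠ 0 ∧ (y i : ℕ) ≠ 0).card

/-- The domain `{(i, j) | i + j ≤ k, j ≤ min k (n - k)}`, where a pair `(i, j)` is the
exponent vector `α` with `α 0 = i` and `α 1 = j`. -/
def nonbinaryJohnsonDomain (n k : ℕ) : Set (Fin 2 →₀ ℕ) :=
  {α | α 0 + α 1 ≤ k ∧ α 1 ≤ min k (n - k)}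

/-- The pair `(i, j)` as an exponent vector. -/
noncomputable def pairIndex (i j : ℕ) : Fin 2 →₀ ℕ :=
  Finsupp.equivFunOnFinite.symm ![i, j]

theorem equalNonzero_le_commonNonzero {n r : ℕ} (x y : Fin n → Fin r) :
    equalNonzero x y ≤ commonNonzero x y := by
  apply Finset.card_le_card
  intro i hi
  simp only [Finset.mem_filter, Finset.mem_univ, true_and] at hi ⊢
  exact ⟨hi.2, hi.1 ▸ hi.2⟩

theorem commonNonzero_eq {n r : ℕ} (x y : Fin n → Fin r) :
    commonNonzero x y = (nonzeroPositions x ∩ nonzeroPositions y).card := by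
  rw [commonNonzero, nonzeroPositions, nonzeroPositions, Finset.filter_and]

theorem commonNonzero_le {r n k : ℕ} (x y : NonbinaryJohnsonPoint r n k) :
    commonNonzero x.1 y.1 ≤ k := by
  rw [commonNonzero_eq]
  exact (Finset.card_le_card Finset.inter_subset_left).trans x.2.le

theorem pairIndex_mem_nonbinaryJohnsonDomain {r n k : ℕ} (x y : NonbinaryJohnsonPoint r n k) :
    pairIndex (commonNonzero x.1 y.1 - equalNonzero x.1 y.1) (k - commonNonzero x.1 y.1) ∈
      nonbinaryJohnsonDomain n k := by
  have h1 := commonNonzero_le x y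
  have h2 := equalNonzero_le_commonNonzero x.1 y.1
  have h3 := Finset.card_union_add_card_inter (nonzeroPositions x.1) (nonzeroPositions y.1)
  have h4 := Finset.card_le_univ (nonzeroPositions x.1 ∪ nonzeroPositions y.1)
  rw [← commonNonzero_eq, x.2, y.2] at h3
  rw [Fintype.card_fin] at h4
  simp only [nonbinaryJohnsonDomain, pairIndex, Set.mem_ofPred_eq,
    Finsupp.equivFunOnFinite_symm_apply_apply,
    Matrix.cons_val_zero, Matrix.cons_val_one]
  omega

/-- The relation map of the nonbinary Johnson scheme `J_r(n, k)`: the value at `(x, y)` is the pair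
`(i, j)` with `e(x, y) = k - i - j` and `c(x, y) = k - j`. -/
noncomputable def nonbinaryJohnson (r n k : ℕ) (x y : NonbinaryJohnsonPoint r n k) :
    nonbinaryJohnsonDomain n k :=
  ⟨pairIndex (commonNonzero x.1 y.1 - equalNonzero x.1 y.1) (k - commonNonzero x.1 y.1),
    pairIndex_mem_nonbinaryJohnsonDomain x y⟩

/-- The defining property of the relation map of `J_r(n, k)`, without truncated subtraction. -/
theorem nonbinaryJohnson_eq_iff {r n k : ℕ} (x y : NonbinaryJohnsonPoint r n k)
    (α : nonbinaryJohnsonDomain n k) :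
    nonbinaryJohnson r n k x y = α ↔
      (equalNonzero x.1 y.1 : ℤ) = k - α.1 0 - α.1 1 ∧
        (commonNonzero x.1 y.1 : ℤ) = k - α.1 1 := by
  have h1 := commonNonzero_le x y
  have h2 := equalNonzero_le_commonNonzero x.1 y.1
  rw [Subtype.ext_iff, Finsupp.ext_iff, Fin.forall_fin_two]
  simp only [nonbinaryJohnson, pairIndex, Finsupp.equivFunOnFinite_symm_apply_apply,
    Matrix.cons_val_zero, Matrix.cons_val_one]
  omega

/-! ### Idempotents of a commutative algebra with a triangular basis -/

section Triangular

variable {σ V W : Type*} [LinearOrder σ] [AddCommGroup V] [Module ℂ V] [AddCommGroup W]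
  [Module ℂ W]

/-! The Bose-Mesner algebra carries two products. Under the Hadamard product it consists of
polynomials in the functions e and c: Lagrange interpolation produces the adjacency matrices, and
products of shifted factors e - t and c - (k - t) that vanish identically reduce every monomial to
exponents in the domain D (`boseMesner_nonbinaryJohnson_eq`). The point is that the filtration by
leading exponent in e and c is also compatible with the matrix product.

For each β in D there is a vector t_β killed by every monomial matrix below β but not by the one at
β (`exists_testVector`). Hence the span of the monomials below α consists of the matrices of the
algebra that kill t_β for all β ≥ α in D. It is therefore a left ideal, and an ideal by
commutativity. The algebra is also reduced, and these ideals form a flag with one-dimensional steps,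
so each step contributes exactly one primitive idempotent E_α, with leading exponent α
(`exists_idempotent_labelling`).

The vector t_β is an alternating sum over a cube of points (`exists_cube`): β 0 directions recolour
an entry from 1 to 2, which needs r ≥ 3, and β 1 directions move a nonzero entry between two
positions. Against a fixed point, e is a constant plus functions of single bits, and c sees only the
moving bits. So e^p c^q expands into products of at most p + q such functions, at most p of them in
colour bits. Unless p ≥ β 0 and p + q ≥ β 0 + β 1, some bit is free and the sum cancels. This
matches the graded lexicographic order.

Finally, the multiples of E_{ε_1} and E_{ε_2} have leading exponents ε_1 and ε_2, so their monomials
define the same filtration as those of e and c (`spanLE_eq_of_leading`). Polynomials of multidegree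
α and the recurrences follow. The scheme axioms come from isometries acting transitively on the
pairs with given e and c (`exists_isometry`). -/

theorem mem_span_image_of_triangular {D p : Set σ} (hp : IsLowerSet p) {B : σ → V}
    {T : σ → V →ₗ[ℂ] W} (h0 : ∀ s ∈ D, ∀ t ∈ D, t < s → T s (B t) = 0)
    (h1 : ∀ s ∈ D, T s (B s) ≠ 0) {v : V} (hv : v ∈ Submodule.span ℂ (B '' D))
    (hT : ∀ t ∈ D, t ∉ p → T t v = 0) :
    v ∈ Submodule.span ℂ (B '' (D ∩ p)) := by
  classical
  obtain ⟨l, hl, rfl⟩ := (Finsupp.mem_span_image_iff_linearCombination ℂ).1 hv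
  rw [Finsupp.mem_supported] at hl
  have hp : ∀ t ∈ l.support, t ∈ p := by
    by_contra! hne
    have hS : (l.support.filter (· ∉ p)).Nonempty :=
      hne.imp fun t ht => Finset.mem_filter.2 ht
    obtain ⟨t, ht, hmax⟩ := (l.support.filter (· ∉ p)).exists_max_image id hS
    rw [Finset.mem_filter] at ht
    -- At the largest index t of the support outside p, the functional T t kills all other terms:
    -- those outside p are smaller by maximality, those in p because p is a lower set. Only the
    -- nonzero term at t survives.
    have h := hT t (hl ht.1) ht.2
    rw [Finsupp.linearCombination_apply, Finsupp.sum, map_sum, Finset.sum_eq_single t] at h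
    · rw [map_smul, smul_eq_zero] at h
      exact h.elim (Finsupp.mem_support_iff.1 ht.1) (h1 t (hl ht.1))
    · intro u hu hut
      rw [map_smul, h0 t (hl ht.1) u (hl hu), smul_zero]
      refine lt_of_le_of_ne (not_lt.1 fun htu => ?_) hut
      by_cases hup : u ∈ p
      · exact ht.2 (hp htu.le hup)
      · exact (hmax u (Finset.mem_filter.2 ⟨hu, hup⟩)).not_gt htu
    · exact fun hn => absurd ht.1 hn
  refine (Finsupp.mem_span_image_iff_linearCombination ℂ).2 ⟨l, ?_, rfl⟩
  rw [Finsupp.mem_supported]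
  exact fun t ht => ⟨hl ht, hp t ht⟩

theorem map_eq_zero_of_mem_span {τ : Type*} {D : Set τ} {B : τ → V} {f : V →ₗ[ℂ] W}
    (h : ∀ t ∈ D, f (B t) = 0) {v : V} (hv : v ∈ Submodule.span ℂ (B '' D)) : f v = 0 := by
  have : Submodule.span ℂ (B '' D) ≤ LinearMap.ker f := by
    rw [Submodule.span_le]
    rintro _ ⟨t, ht, rfl⟩
    exact h t ht
  exact this hv

theorem span_image_Iic_le {D : Set σ} {B : σ → V} {s : σ} {v : V}
    (hv : v ∈ Submodule.span ℂ (B '' (D ∩ Set.Iic s))) :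
    ∃ a : ℂ, v - a • B s ∈ Submodule.span ℂ (B '' (D ∩ Set.Iio s)) := by
  have hle : Submodule.span ℂ (B '' (D ∩ Set.Iic s)) ≤
      Submodule.span ℂ (insert (B s) (B '' (D ∩ Set.Iio s))) := by
    refine Submodule.span_mono ?_
    rintro _ ⟨t, ⟨ht, hts⟩, rfl⟩
    rcases eq_or_lt_of_le (Set.mem_Iic.1 hts) with rfl | h
    · exact Or.inl rfl
    · exact Or.inr ⟨t, ⟨ht, h⟩, rfl⟩
  obtain ⟨a, z, hz, rfl⟩ := Submodule.mem_span_insert.1 (hle hv)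
  exact ⟨a, by simpa using hz⟩

/-- If `E` has leading term `s`, every element with leading term at most `s` is a multiple of `E`
up to lower terms. -/
theorem exists_sub_smul_mem {D : Set σ} {B : σ → V} {s : σ} {v w : V}
    (hv : v ∈ Submodule.span ℂ (B '' (D ∩ Set.Iic s)))
    (hw : w ∈ Submodule.span ℂ (B '' (D ∩ Set.Iic s)))
    (hw' : w ∉ Submodule.span ℂ (B '' (D ∩ Set.Iio s))) :
    ∃ a : ℂ, v - a • w ∈ Submodule.span ℂ (B '' (D ∩ Set.Iio s)) := by
  obtain ⟨a, ha⟩ := span_image_Iic_le hv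
  obtain ⟨b, hb⟩ := span_image_Iic_le hw
  have hb0 : b ≠ 0 := by
    rintro rfl
    exact hw' (by simpa using hb)
  refine ⟨a / b, ?_⟩
  have : v - (a / b) • w = (v - a • B s) - (a / b) • (w - b • B s) := by
    rw [smul_sub, smul_smul, div_mul_cancel₀ _ hb0]
    abel
  rw [this]
  exact Submodule.sub_mem _ ha (Submodule.smul_mem _ _ hb)

/-- A triangular change of family with nonzero diagonal is invertible: B u is a multiple of E u up
to lower terms, and these are handled by well-founded induction. -/
theorem span_image_Iio_le_of_triangular [WellFoundedLT σ] {D : Set σ} {B E : σ → V} (s : σ)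
    (hE : ∀ u < s, u ∈ D → E u ∈ Submodule.span ℂ (B '' (D ∩ Set.Iic u)) ∧
      E u ∉ Submodule.span ℂ (B '' (D ∩ Set.Iio u))) :
    Submodule.span ℂ (B '' (D ∩ Set.Iio s)) ≤ Submodule.span ℂ (E '' (D ∩ Set.Iio s)) := by
  induction s using WellFoundedLT.induction with
  | ind s ih =>
    rw [Submodule.span_le]
    rintro _ ⟨u, ⟨hu, hus⟩, rfl⟩
    rw [Set.mem_Iio] at hus
    have hB : B u ∈ Submodule.span ℂ (B '' (D ∩ Set.Iic u)) :=
      Submodule.subset_span ⟨u, ⟨hu, le_rfl⟩, rfl⟩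
    obtain ⟨a, ha⟩ := exists_sub_smul_mem hB (hE u hus hu).1 (hE u hus hu).2
    have h1 := ih u hus (fun v hv hvD => hE v (hv.trans hus) hvD) ha
    have h2 : Submodule.span ℂ (E '' (D ∩ Set.Iio u)) ≤
        Submodule.span ℂ (E '' (D ∩ Set.Iio s)) :=
      Submodule.span_mono (Set.image_mono fun v hv => ⟨hv.1, lt_trans hv.2 hus⟩)
    have h3 : E u ∈ Submodule.span ℂ (E '' (D ∩ Set.Iio s)) :=
      Submodule.subset_span ⟨u, ⟨hu, hus⟩, rfl⟩
    have := Submodule.add_mem _ (h2 h1) (Submodule.smul_mem _ a h3)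
    simpa using this

end Triangular

/-! ### Primitive idempotents from a flag of ideals -/

section Idempotents

variable {X σ : Type*} [Fintype X] [DecidableEq X] [LinearOrder σ] [WellFoundedLT σ]

theorem mul_eq_zero_of_mem_span {S : Set (Matrix X X ℂ)} {M N : Matrix X X ℂ}
    (hS : ∀ F ∈ S, M * F = 0) (hN : N ∈ Submodule.span ℂ S) : M * N = 0 := by
  have : Submodule.span ℂ S ≤ LinearMap.ker (LinearMap.mulLeft ℂ M) := by
    rw [Submodule.span_le]
    exact fun F hF => hS F hF
  exact this hN

/-- The test vectors t s make every span over a lower set an ideal. In a commutative reduced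
algebra, a flag of ideals with one-dimensional steps acquires one new primitive idempotent at each
step. -/
theorem exists_idempotent_labelling {𝔄 : Submodule ℂ (Matrix X X ℂ)} {D : Set σ}
    (hD : D.Finite) {B : σ → Matrix X X ℂ} {t : σ → X → ℂ}
    (hspan : 𝔄 = Submodule.span ℂ (B '' D)) (hmul : ∀ M ∈ 𝔄, ∀ N ∈ 𝔄, M * N ∈ 𝔄)
    (hcomm : ∀ M ∈ 𝔄, ∀ N ∈ 𝔄, M * N = N * M) (hred : ∀ M ∈ 𝔄, M * M = 0 → M = 0)
    (h0 : ∀ s ∈ D, ∀ u ∈ D, u < s → Matrix.mulVec (B u) (t s) = 0)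
    (h1 : ∀ s ∈ D, Matrix.mulVec (B s) (t s) ≠ 0) :
    ∃ E : σ → Matrix X X ℂ, Set.BijOn E D {F | IsPrimitiveIdempotent 𝔄 F} ∧
      ∀ s ∈ D, E s ∈ Submodule.span ℂ (B '' (D ∩ Set.Iic s)) ∧
        E s ∉ Submodule.span ℂ (B '' (D ∩ Set.Iio s)) := by
  classical
  let T : σ → Matrix X X ℂ →ₗ[ℂ] (X → ℂ) := fun s =>
    { toFun := fun M => Matrix.mulVec M (t s)
      map_add' := fun M N => Matrix.add_mulVec M N (t s)
      map_smul' := fun a M => Matrix.smul_mulVec a M (t s) }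
  have hle : ∀ p : Set σ, Submodule.span ℂ (B '' (D ∩ p)) ≤ 𝔄 := fun p => by
    rw [hspan]
    exact Submodule.span_mono (Set.image_mono Set.inter_subset_left)
  -- Membership in the span over p means killing the vectors t s with s outside p, a condition
  -- preserved by left multiplication.
  have hideal : ∀ p : Set σ, IsLowerSet p → ∀ N ∈ Submodule.span ℂ (B '' (D ∩ p)), ∀ M ∈ 𝔄,
      M * N ∈ Submodule.span ℂ (B '' (D ∩ p)) := by
    intro p hp N hN M hM
    refine mem_span_image_of_triangular (T := T) hp h0 h1
      (hspan ▸ hmul M hM N (hle p hN)) fun s hs hsp => ?_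
    have : T s N = 0 := map_eq_zero_of_mem_span (fun u hu => h0 s hs u hu.1
      (not_le.1 fun hsu => hsp (hp hsu hu.2))) hN
    change Matrix.mulVec (M * N) (t s) = 0
    rw [← Matrix.mulVec_mulVec]
    change Matrix.mulVec M (T s N) = 0
    rw [this, Matrix.mulVec_zero]
  have hmono : ∀ {u s : σ}, u < s → Submodule.span ℂ (B '' (D ∩ Set.Iic u)) ≤
      Submodule.span ℂ (B '' (D ∩ Set.Iio s)) := fun h =>
    Submodule.span_mono (Set.image_mono fun v hv => ⟨hv.1, lt_of_le_of_lt hv.2 h⟩)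
  have hlt : ∀ s : σ, Submodule.span ℂ (B '' (D ∩ Set.Iio s)) ≤
      Submodule.span ℂ (B '' (D ∩ Set.Iic s)) := fun s =>
    Submodule.span_mono (Set.image_mono fun v hv => ⟨hv.1, le_of_lt hv.2⟩)
  have hex : ∀ s, s ∈ D → ∃ F : Matrix X X ℂ,
      F ∈ Submodule.span ℂ (B '' (D ∩ Set.Iic s)) ∧
      F ∉ Submodule.span ℂ (B '' (D ∩ Set.Iio s)) ∧ F * F = F ∧
      ∀ N ∈ Submodule.span ℂ (B '' (D ∩ Set.Iio s)), F * N = 0 := by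
    intro s
    induction s using WellFoundedLT.induction with
    | ind s ih =>
      intro hs
      choose! E hE using ih
      have hEA : ∀ u < s, u ∈ D → E u ∈ 𝔄 := fun u hu huD => hle _ (hE u hu huD).1
      have horth : ∀ u < s, u ∈ D → ∀ v < s, v ∈ D → v ≠ u → E v * E u = 0 := by
        intro u hu huD v hv hvD hvu
        rcases lt_or_gt_of_ne hvu with h | h
        · rw [hcomm _ (hEA v hv hvD) _ (hEA u hu huD)]
          exact (hE u hu huD).2.2.2 _ (hmono h (hE v hv hvD).1)
        · exact (hE v hv hvD).2.2.2 _ (hmono h (hE u hu huD).1)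
      have hspanE := span_image_Iio_le_of_triangular (B := B) (D := D) (E := E) s
        fun u hu huD => ⟨(hE u hu huD).1, (hE u hu huD).2.1⟩
      -- The ideal below s is spanned by the earlier idempotents, so an element of it that they all
      -- annihilate has square zero.
      have hzero : ∀ N ∈ Submodule.span ℂ (B '' (D ∩ Set.Iio s)),
          (∀ u < s, u ∈ D → N * E u = 0) → N = 0 := by
        intro N hN h
        refine hred N (hle _ hN) (mul_eq_zero_of_mem_span ?_ (hspanE hN))
        rintro _ ⟨u, ⟨huD, hu⟩, rfl⟩
        exact h u hu huD
      have hBs : B s ∈ Submodule.span ℂ (B '' (D ∩ Set.Iic s)) :=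
        Submodule.subset_span ⟨s, ⟨hs, le_rfl⟩, rfl⟩
      have hBs' : B s ∉ Submodule.span ℂ (B '' (D ∩ Set.Iio s)) := fun h =>
        h1 s hs (map_eq_zero_of_mem_span (f := T s) (fun u hu => h0 s hs u hu.1 hu.2) h)
      -- C is B s with its components along the earlier idempotents removed; the leading term is
      -- unchanged.
      let C := B s - ∑ u ∈ hD.toFinset.filter (· < s), B s * E u
      have hsum : ∑ u ∈ hD.toFinset.filter (· < s), B s * E u ∈
          Submodule.span ℂ (B '' (D ∩ Set.Iio s)) := by
        refine Submodule.sum_mem _ fun u hu => ?_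
        rw [Finset.mem_filter, Set.Finite.mem_toFinset] at hu
        exact hideal _ (isLowerSet_Iio s) _ (hmono hu.2 (hE u hu.2 hu.1).1) _ (hle _ hBs)
      have hC : C ∈ Submodule.span ℂ (B '' (D ∩ Set.Iic s)) :=
        Submodule.sub_mem _ hBs (hlt s hsum)
      have hC' : C ∉ Submodule.span ℂ (B '' (D ∩ Set.Iio s)) := fun h =>
        hBs' ((Submodule.sub_mem_iff_left _ hsum).1 h)
      have hCE : ∀ u < s, u ∈ D → C * E u = 0 := by
        intro u hu huD
        have hmem : u ∈ hD.toFinset.filter (· < s) := by simp [hu, huD]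
        rw [sub_mul, Finset.sum_mul, Finset.sum_eq_single u, Matrix.mul_assoc,
          (hE u hu huD).2.2.1, sub_self]
        · intro v hv hvu
          rw [Finset.mem_filter, Set.Finite.mem_toFinset] at hv
          rw [Matrix.mul_assoc, horth u hu huD v hv.2 hv.1 hvu, Matrix.mul_zero]
        · exact fun h => absurd hmem h
      obtain ⟨a, ha⟩ := exists_sub_smul_mem
        (hideal _ (isLowerSet_Iic s) _ hC _ (hle _ hC)) hC hC'
      -- The difference lies in the ideal below s and is annihilated by all earlier idempotents, so
      -- it vanishes exactly and not only modulo lower terms.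
      have hCC : C * C = a • C := by
        refine sub_eq_zero.1 (hzero _ ha fun u hu huD => ?_)
        rw [sub_mul, Matrix.mul_assoc, hCE u hu huD, Matrix.smul_mul, hCE u hu huD,
          Matrix.mul_zero, smul_zero, sub_zero]
      have ha0 : a ≠ 0 := by
        rintro rfl
        rw [zero_smul] at hCC
        exact hC' (hred C (hle _ hC) hCC ▸ Submodule.zero_mem _)
      refine ⟨a⁻¹ • C, Submodule.smul_mem _ _ hC, fun h => hC' ?_, ?_, fun N hN => ?_⟩
      · exact (Submodule.smul_mem_iff _ (inv_ne_zero ha0)).1 h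
      · rw [Matrix.smul_mul, Matrix.mul_smul, hCC, smul_smul a⁻¹ a, inv_mul_cancel₀ ha0,
          one_smul]
      · rw [Matrix.smul_mul, mul_eq_zero_of_mem_span (S := E '' (D ∩ Set.Iio s)) ?_ (hspanE hN),
          smul_zero]
        rintro _ ⟨u, ⟨huD, hu⟩, rfl⟩
        exact hCE u hu huD
  choose! E hE using hex
  have hEA : ∀ u ∈ D, E u ∈ 𝔄 := fun u hu => hle _ (hE u hu).1
  have hne : ∀ u ∈ D, E u ≠ 0 := fun u hu h => (hE u hu).2.1 (h ▸ Submodule.zero_mem _)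
  have horth : ∀ u ∈ D, ∀ v ∈ D, v ≠ u → E v * E u = 0 := by
    intro u hu v hv hvu
    rcases lt_or_gt_of_ne hvu with h | h
    · rw [hcomm _ (hEA v hv) _ (hEA u hu)]
      exact (hE u hu).2.2.2 _ (hmono h (hE v hv).1)
    · exact (hE v hv).2.2.2 _ (hmono h (hE u hu).1)
  have hspanE : 𝔄 ≤ Submodule.span ℂ (E '' D) := by
    rw [hspan, Submodule.span_le]
    rintro _ ⟨u, hu, rfl⟩
    have hB : B u ∈ Submodule.span ℂ (B '' (D ∩ Set.Iic u)) :=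
      Submodule.subset_span ⟨u, ⟨hu, le_rfl⟩, rfl⟩
    obtain ⟨a, ha⟩ := exists_sub_smul_mem hB (hE u hu).1 (hE u hu).2.1
    have h2 := span_image_Iio_le_of_triangular (B := B) (D := D) (E := E) u
      (fun v _ hv => ⟨(hE v hv).1, (hE v hv).2.1⟩) ha
    have h3 := Submodule.span_mono (Set.image_mono Set.inter_subset_left) h2
    have h4 : E u ∈ Submodule.span ℂ (E '' D) := Submodule.subset_span ⟨u, hu, rfl⟩
    simpa using Submodule.add_mem _ h3 (Submodule.smul_mem _ a h4)
  -- E u * F is a multiple of E u modulo the ideal below u; multiplying by E u once more kills that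
  -- ideal.
  have hscal : ∀ u ∈ D, ∀ F ∈ 𝔄, ∃ a : ℂ, E u * F = a • E u := by
    intro u hu F hF
    have h2 : E u * F ∈ Submodule.span ℂ (B '' (D ∩ Set.Iic u)) := by
      rw [hcomm _ (hEA u hu) _ hF]
      exact hideal _ (isLowerSet_Iic u) _ (hE u hu).1 _ hF
    obtain ⟨a, ha⟩ := exists_sub_smul_mem h2 (hE u hu).1 (hE u hu).2.1
    refine ⟨a, ?_⟩
    have := (hE u hu).2.2.2 _ ha
    rwa [mul_sub, ← Matrix.mul_assoc, Matrix.mul_smul, (hE u hu).2.2.1, sub_eq_zero] at this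
  have hidem : ∀ u ∈ D, ∀ a : ℂ, (a • E u) * (a • E u) = a • E u → a = 0 ∨ a = 1 := by
    intro u hu a h
    rw [Matrix.smul_mul, Matrix.mul_smul, (hE u hu).2.2.1, smul_smul, ← sub_eq_zero, ← sub_smul,
      smul_eq_zero] at h
    have h := h.resolve_right (hne u hu)
    rcases eq_or_ne a 0 with h' | h'
    · exact Or.inl h'
    · exact Or.inr (mul_left_cancel₀ h' (by rw [mul_one]; exact sub_eq_zero.1 h))
  refine ⟨E, ⟨fun u hu => ?_, fun u hu v hv huv => ?_, fun F hF => ?_⟩,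
    fun s hs => ⟨(hE s hs).1, (hE s hs).2.1⟩⟩
  · refine ⟨hEA u hu, hne u hu, (hE u hu).2.2.1, fun F hF hFF hEF _ => ?_⟩
    obtain ⟨a, ha⟩ := hscal u hu F hF
    rw [hEF] at ha
    rcases hidem u hu a (ha ▸ hFF) with rfl | rfl
    · exact Or.inl (by rw [ha, zero_smul])
    · exact Or.inr (by rw [ha, one_smul])
  · by_contra hne'
    refine hne u hu ?_
    rw [← (hE u hu).2.2.1]
    nth_rw 2 [huv]
    exact horth v hv u hu hne'
  · obtain ⟨hFA, hF0, hFF, hmin⟩ := hF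
    -- Since the E u span the algebra, a nonzero idempotent F meets some E u. The product is a
    -- nonzero idempotent multiple of E u, hence equal to E u, and minimality of F gives F = E u.
    have : ∃ u ∈ D, E u * F ≠ 0 := by
      by_contra! h
      refine hF0 ?_
      rw [← hFF]
      refine mul_eq_zero_of_mem_span ?_ (hspanE hFA)
      rintro _ ⟨u, hu, rfl⟩
      rw [hcomm _ hFA _ (hEA u hu), h u hu]
    obtain ⟨u, hu, hne'⟩ := this
    obtain ⟨a, ha⟩ := hscal u hu F hFA
    have hcm := hcomm _ hFA _ (hEA u hu)
    have hsq : (E u * F) * (E u * F) = E u * F := by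
      rw [Matrix.mul_assoc, ← Matrix.mul_assoc F, hcm, Matrix.mul_assoc, hFF,
        ← Matrix.mul_assoc, (hE u hu).2.2.1]
    rw [ha] at hsq
    have hEF : E u * F = E u := by
      rcases hidem u hu a hsq with rfl | rfl
      · exact absurd (by rw [ha, zero_smul]) hne'
      · rw [ha, one_smul]
    refine ⟨u, hu, ?_⟩
    exact (hmin (E u) (hEA u hu) (hE u hu).2.2.1 (by rw [hcm, hEF]) hEF).resolve_left (hne u hu)

end Idempotents

/-! ### Spans of monomials below a monomial order -/

section MonomialSpan

variable {l : ℕ} {𝓕 : Type*} [CommRing 𝓕] [Algebra ℂ 𝓕] (m : MonomialOrder (Fin l))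

/-- The monomial `∏ g_i ^ α_i` in the elements `g_i` of a commutative algebra. -/
def monomialValue (g : Fin l → 𝓕) (α : Fin l →₀ ℕ) : 𝓕 := ∏ i, g i ^ α i

/-- The span of the monomials of degree at most `α`. -/
def spanLE (g : Fin l → 𝓕) (α : Fin l →₀ ℕ) : Submodule ℂ 𝓕 :=
  Submodule.span ℂ (monomialValue g '' {β | m.toSyn β ≤ m.toSyn α})

/-- The span of the monomials of degree less than `α`. -/
def spanLT (g : Fin l → 𝓕) (α : Fin l →₀ ℕ) : Submodule ℂ 𝓕 :=
  Submodule.span ℂ (monomialValue g '' {β | m.toSyn β < m.toSyn α})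

variable {m} {g h : Fin l → 𝓕} {α β : Fin l →₀ ℕ}

omit [Algebra ℂ 𝓕] in
theorem monomialValue_add : monomialValue g (α + β) = monomialValue g α * monomialValue g β := by
  simp [monomialValue, pow_add, Finset.prod_mul_distrib]

omit [Algebra ℂ 𝓕] in
theorem monomialValue_zero : monomialValue g 0 = 1 := by
  simp [monomialValue]

omit [Algebra ℂ 𝓕] in
theorem monomialValue_unitIndex (i : Fin l) : monomialValue g (unitIndex i) = g i := by
  rw [monomialValue, Finset.prod_eq_single i]
  · simp [unitIndex]
  · intro j _ hj
    simp [unitIndex, Finsupp.single_eq_of_ne hj]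
  · simp

theorem monomialValue_mem_spanLE (hβ : m.toSyn β ≤ m.toSyn α) :
    monomialValue g β ∈ spanLE m g α := Submodule.subset_span ⟨β, hβ, rfl⟩

theorem monomialValue_mem_spanLT (hβ : m.toSyn β < m.toSyn α) :
    monomialValue g β ∈ spanLT m g α := Submodule.subset_span ⟨β, hβ, rfl⟩

theorem spanLE_mono (hβ : m.toSyn β ≤ m.toSyn α) : spanLE m g β ≤ spanLE m g α :=
  Submodule.span_mono (Set.image_mono fun _ h => le_trans h hβ)

theorem spanLE_le_spanLT (hβ : m.toSyn β < m.toSyn α) : spanLE m g β ≤ spanLT m g α :=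
  Submodule.span_mono (Set.image_mono fun _ h => lt_of_le_of_lt h hβ)

theorem spanLT_le_spanLE : spanLT m g α ≤ spanLE m g α :=
  Submodule.span_mono (Set.image_mono fun _ h => le_of_lt h)

theorem mul_mem_spanLE {x y : 𝓕} (hx : x ∈ spanLE m g α) (hy : y ∈ spanLE m g β) :
    x * y ∈ spanLE m g (α + β) := by
  have : spanLE m g α * spanLE m g β ≤ spanLE m g (α + β) := by
    rw [spanLE, spanLE, Submodule.span_mul_span, Submodule.span_le]
    rintro _ ⟨_, ⟨a, ha, rfl⟩, _, ⟨b, hb, rfl⟩, rfl⟩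
    change monomialValue g a * monomialValue g b ∈ _
    rw [← monomialValue_add]
    refine monomialValue_mem_spanLE ?_
    rw [map_add, map_add]
    exact add_le_add ha hb
  exact this (Submodule.mul_mem_mul hx hy)

theorem mul_mem_spanLT {x y : 𝓕} (hx : x ∈ spanLE m g α) (hy : y ∈ spanLT m g β) :
    x * y ∈ spanLT m g (α + β) := by
  have : spanLE m g α * spanLT m g β ≤ spanLT m g (α + β) := by
    rw [spanLE, spanLT, Submodule.span_mul_span, Submodule.span_le]
    rintro _ ⟨_, ⟨a, ha, rfl⟩, _, ⟨b, hb, rfl⟩, rfl⟩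
    change monomialValue g a * monomialValue g b ∈ _
    rw [← monomialValue_add]
    refine monomialValue_mem_spanLT ?_
    rw [map_add, map_add]
    exact add_lt_add_of_le_of_lt ha hb
  exact this (Submodule.mul_mem_mul hx hy)

theorem algebraMap_mem_spanLE (a : ℂ) : algebraMap ℂ 𝓕 a ∈ spanLE m g α := by
  rw [Algebra.algebraMap_eq_smul_one, ← monomialValue_zero (g := g)]
  exact Submodule.smul_mem _ _ (monomialValue_mem_spanLE (by simp))

theorem sub_monomialValue_mul_mem {x y : 𝓕} (hx : x - monomialValue g α ∈ spanLT m g α)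
    (hy : y - monomialValue g β ∈ spanLT m g β) :
    x * y - monomialValue g (α + β) ∈ spanLT m g (α + β) := by
  have hx' : x ∈ spanLE m g α := by
    have := Submodule.add_mem _ (spanLT_le_spanLE hx)
      (monomialValue_mem_spanLE (g := g) (le_refl (m.toSyn α)))
    rwa [sub_add_cancel] at this
  have h1 := mul_mem_spanLT hx' hy
  have h2 := mul_mem_spanLT (monomialValue_mem_spanLE (g := g) (le_refl (m.toSyn β))) hx
  rw [add_comm β α] at h2
  have : x * y - monomialValue g (α + β) =
      x * (y - monomialValue g β) + monomialValue g β * (x - monomialValue g α) := by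
    rw [monomialValue_add]
    ring
  rw [this]
  exact Submodule.add_mem _ h1 h2

/-- Shifting the factors by constants does not alter the leading monomial g_i^n; the shifts a t are
later chosen so that such products vanish at prescribed values. -/
theorem prod_sub_algebraMap_sub_monomialValue_mem (i : Fin l) (a : ℕ → ℂ) (n : ℕ) :
    ∏ t ∈ Finset.range n, (g i - algebraMap ℂ 𝓕 (a t)) - monomialValue g (n • unitIndex i) ∈
      spanLT m g (n • unitIndex i) := by
  induction n with
  | zero => simp [monomialValue_zero]
  | succ n ih =>
    rw [Finset.prod_range_succ, succ_nsmul]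
    refine sub_monomialValue_mul_mem ih ?_
    rw [monomialValue_unitIndex, sub_sub_cancel_left]
    refine Submodule.neg_mem _ (spanLE_le_spanLT (β := 0) ?_ (algebraMap_mem_spanLE _))
    rw [map_zero]
    exact (MonomialOrder.toSyn_lt_iff_ne_zero (m := m)).2
      (by rw [Ne, m.toSyn_eq_zero_iff]; simp [unitIndex])

/-- Induction on exponent vectors: a vector is zero, a unit vector, or a sum of two vectors that
are smaller in the monomial order. -/
theorem eq_unitIndex_or_exists_add (m : MonomialOrder (Fin l)) (α : Fin l →₀ ℕ) :
    α = 0 ∨ (∃ i, α = unitIndex i) ∨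
      ∃ β γ, α = β + γ ∧ m.toSyn β < m.toSyn α ∧ m.toSyn γ < m.toSyn α := by
  rcases eq_or_ne α 0 with h0 | h0
  · exact Or.inl h0
  obtain ⟨i, hi⟩ := Finsupp.ne_iff.1 h0
  have hle : unitIndex i ≤ α := by
    rw [unitIndex, Finsupp.single_le_iff]
    exact Nat.one_le_iff_ne_zero.2 hi
  have hadd : α = unitIndex i + (α - unitIndex i) := (add_tsub_cancel_of_le hle).symm
  rcases eq_or_ne (α - unitIndex i) 0 with h1 | h1
  · exact Or.inr (Or.inl ⟨i, by rw [hadd, h1, add_zero]⟩)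
  refine Or.inr (Or.inr ⟨unitIndex i, α - unitIndex i, hadd, ?_, ?_⟩)
  · refine m.toSyn_strictMono (lt_of_le_of_ne hle fun h => h1 ?_)
    rw [← h, tsub_self]
  · refine m.toSyn_strictMono (lt_of_le_of_ne tsub_le_self fun h => ?_)
    have := DFunLike.congr_fun h i
    rw [Finsupp.tsub_apply, unitIndex, Finsupp.single_eq_same] at this
    rw [Finsupp.coe_zero, Pi.zero_apply] at hi
    omega

theorem spanLE_le_of_forall_mem (hh : ∀ i, h i ∈ spanLE m g (unitIndex i)) (α : Fin l →₀ ℕ) :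
    spanLE m h α ≤ spanLE m g α := by
  have key : ∀ s : m.syn, ∀ β, m.toSyn β = s → monomialValue h β ∈ spanLE m g β := by
    intro s
    induction s using WellFoundedLT.induction with
    | ind s ih =>
      rintro β rfl
      rcases eq_unitIndex_or_exists_add m β with rfl | ⟨i, rfl⟩ | ⟨γ, δ, rfl, hγ, hδ⟩
      · rw [monomialValue_zero, ← monomialValue_zero (g := g)]
        exact monomialValue_mem_spanLE le_rfl
      · rw [monomialValue_unitIndex]
        exact hh i
      · rw [monomialValue_add]
        exact mul_mem_spanLE (ih _ hγ γ rfl) (ih _ hδ δ rfl)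
  rw [spanLE, Submodule.span_le]
  rintro _ ⟨β, hβ, rfl⟩
  exact spanLE_mono hβ (key _ β rfl)

/-- The leading coefficient of h i is nonzero, so g i can be solved for in terms of h i and lower
monomials. In a general monomial order these may involve powers of other variables, hence the
induction along the order. -/
theorem spanLE_le_of_forall_notMem (hh : ∀ i, h i ∈ spanLE m g (unitIndex i))
    (hh' : ∀ i, h i ∉ spanLT m g (unitIndex i)) (α : Fin l →₀ ℕ) :
    spanLE m g α ≤ spanLE m h α := by
  have key : ∀ s : m.syn, ∀ β, m.toSyn β = s → monomialValue g β ∈ spanLE m h β := by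
    intro s
    induction s using WellFoundedLT.induction with
    | ind s ih =>
      rintro β rfl
      rcases eq_unitIndex_or_exists_add m β with rfl | ⟨i, rfl⟩ | ⟨γ, δ, rfl, hγ, hδ⟩
      · rw [monomialValue_zero, ← monomialValue_zero (g := h)]
        exact monomialValue_mem_spanLE le_rfl
      · have hlow : spanLT m g (unitIndex i) ≤ spanLE m h (unitIndex i) := by
          rw [spanLT, Submodule.span_le]
          rintro _ ⟨γ, hγ, rfl⟩
          exact spanLE_mono (le_of_lt hγ) (ih _ hγ γ rfl)
        have hsub : spanLE m g (unitIndex i) ≤ Submodule.span ℂ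
            (insert (g i) (monomialValue g '' {β | m.toSyn β < m.toSyn (unitIndex i)})) := by
          refine Submodule.span_mono ?_
          rintro _ ⟨γ, hγ, rfl⟩
          rcases eq_or_lt_of_le (Set.mem_ofPred.1 hγ) with h1 | h1
          · rw [m.toSyn.injective h1, monomialValue_unitIndex]
            exact Or.inl rfl
          · exact Or.inr ⟨γ, h1, rfl⟩
        obtain ⟨a, w, hw, haw⟩ := Submodule.mem_span_insert.1 (hsub (hh i))
        have ha : a ≠ 0 := by
          rintro rfl
          refine hh' i ?_
          rw [haw, zero_smul, zero_add]
          exact hw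
        rw [monomialValue_unitIndex]
        have : g i = a⁻¹ • (h i - w) := by
          rw [haw, add_sub_cancel_right, smul_smul, inv_mul_cancel₀ ha, one_smul]
        rw [this]
        refine Submodule.smul_mem _ _ (Submodule.sub_mem _ ?_ (hlow hw))
        have := monomialValue_mem_spanLE (g := h) (le_refl (m.toSyn (unitIndex i)))
        rwa [monomialValue_unitIndex] at this
      · rw [monomialValue_add]
        exact mul_mem_spanLE (ih _ hγ γ rfl) (ih _ hδ δ rfl)
  rw [spanLE, Submodule.span_le]
  rintro _ ⟨β, hβ, rfl⟩
  exact spanLE_mono hβ (key _ β rfl)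

theorem spanLT_le_of_spanLE_le (hgh : ∀ α, spanLE m g α ≤ spanLE m h α) (α : Fin l →₀ ℕ) :
    spanLT m g α ≤ spanLT m h α := by
  rw [spanLT, Submodule.span_le]
  rintro _ ⟨β, hβ, rfl⟩
  exact spanLE_le_spanLT hβ (hgh β (monomialValue_mem_spanLE le_rfl))

variable {D : Set (Fin l →₀ ℕ)}

/-- Exponents outside D are rewritten by smaller ones; the process stops because a monomial order is
well-founded. -/
theorem monomialValue_mem_span_inter (hD : ∀ γ ∉ D, monomialValue g γ ∈ spanLT m g γ)
    (γ : Fin l →₀ ℕ) :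
    monomialValue g γ ∈
      Submodule.span ℂ (monomialValue g '' (D ∩ {β | m.toSyn β ≤ m.toSyn γ})) := by
  have key : ∀ s : m.syn, ∀ γ, m.toSyn γ = s → monomialValue g γ ∈
      Submodule.span ℂ (monomialValue g '' (D ∩ {β | m.toSyn β ≤ m.toSyn γ})) := by
    intro s
    induction s using WellFoundedLT.induction with
    | ind s ih =>
      rintro γ rfl
      by_cases hγ : γ ∈ D
      · exact Submodule.subset_span ⟨γ, ⟨hγ, le_rfl⟩, rfl⟩
      · refine (Submodule.span_le.2 ?_ : spanLT m g γ ≤ _) (hD γ hγ)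
        rintro _ ⟨β, hβ, rfl⟩
        refine Submodule.span_mono (Set.image_mono (Set.inter_subset_inter_right D ?_))
          (ih _ hβ β rfl)
        exact fun δ hδ => le_trans hδ (le_of_lt hβ)
  exact key _ γ rfl

theorem spanLE_eq_span_inter (hD : ∀ γ ∉ D, monomialValue g γ ∈ spanLT m g γ)
    (α : Fin l →₀ ℕ) :
    spanLE m g α =
      Submodule.span ℂ (monomialValue g '' (D ∩ {β | m.toSyn β ≤ m.toSyn α})) := by
  refine le_antisymm (Submodule.span_le.2 ?_)
    (Submodule.span_mono (Set.image_mono Set.inter_subset_right))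
  rintro _ ⟨β, hβ, rfl⟩
  refine Submodule.span_mono (Set.image_mono (Set.inter_subset_inter_right D ?_))
    (monomialValue_mem_span_inter hD β)
  exact fun δ hδ => le_trans hδ hβ

theorem spanLT_eq_span_inter (hD : ∀ γ ∉ D, monomialValue g γ ∈ spanLT m g γ)
    (α : Fin l →₀ ℕ) :
    spanLT m g α =
      Submodule.span ℂ (monomialValue g '' (D ∩ {β | m.toSyn β < m.toSyn α})) := by
  refine le_antisymm (Submodule.span_le.2 ?_)
    (Submodule.span_mono (Set.image_mono Set.inter_subset_right))
  rintro _ ⟨β, hβ, rfl⟩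
  refine Submodule.span_mono (Set.image_mono (Set.inter_subset_inter_right D ?_))
    (monomialValue_mem_span_inter hD β)
  exact fun δ hδ => lt_of_le_of_lt hδ hβ

theorem mem_span_range_monomialValue_of_mem_adjoin {x : 𝓕}
    (hx : x ∈ Algebra.adjoin ℂ (Set.range g)) :
    x ∈ Submodule.span ℂ (Set.range (monomialValue g)) := by
  induction hx using Algebra.adjoin_induction with
  | mem x hx =>
    obtain ⟨i, rfl⟩ := hx
    exact Submodule.subset_span ⟨unitIndex i, monomialValue_unitIndex i⟩
  | algebraMap a =>
    rw [Algebra.algebraMap_eq_smul_one]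
    exact Submodule.smul_mem _ _ (Submodule.subset_span ⟨0, monomialValue_zero⟩)
  | add x y _ _ hx hy => exact Submodule.add_mem _ hx hy
  | mul x y _ _ hx hy =>
    have := Submodule.mul_mem_mul hx hy
    rw [Submodule.span_mul_span] at this
    refine Submodule.span_mono ?_ this
    rintro _ ⟨_, ⟨a, rfl⟩, _, ⟨b, rfl⟩, rfl⟩
    exact ⟨a + b, monomialValue_add⟩

end MonomialSpan

/-! ### The Bose-Mesner algebra of a symmetric relation map -/

section BoseMesner

variable {X I : Type*} [DecidableEq I] {R : X → X → I}

theorem adjacencyMatrix_apply (i : I) (x y : X) :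
    adjacencyMatrix R i x y = if R x y = i then 1 else 0 := rfl

theorem adjacencyMatrix_mem_boseMesner (i : I) : adjacencyMatrix R i ∈ boseMesner R :=
  Submodule.subset_span ⟨i, rfl⟩

theorem mem_boseMesner_of_apply_eq [Fintype X] {M : Matrix X X ℂ} (f : I → ℂ)
    (hM : ∀ x y, M x y = f (R x y)) : M ∈ boseMesner R := by
  -- The index type is not assumed finite, so the sum runs over the values that R takes.
  have : M = ∑ i ∈ Finset.univ.image (fun p : X × X => R p.1 p.2),
      f i • adjacencyMatrix R i := by
    ext x y
    rw [Matrix.sum_apply, Finset.sum_eq_single (R x y)]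
    · simp [adjacencyMatrix_apply, hM]
    · intro i _ hi
      simp [adjacencyMatrix_apply, hi.symm]
    · intro h
      exact absurd (Finset.mem_image.2 ⟨(x, y), Finset.mem_univ _, rfl⟩) h
  rw [this]
  exact Submodule.sum_mem _ fun i _ =>
    Submodule.smul_mem _ _ (adjacencyMatrix_mem_boseMesner i)

theorem mem_boseMesner_of_const [Fintype X] {M : Matrix X X ℂ}
    (hM : ∀ x y x' y', R x y = R x' y' → M x y = M x' y') : M ∈ boseMesner R := by
  have hf : Function.FactorsThrough (fun p : X × X => M p.1 p.2) (fun p : X × X => R p.1 p.2) :=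
    fun p q h => hM _ _ _ _ h
  -- The default value 0 is used only at indices that R does not take.
  exact mem_boseMesner_of_apply_eq (Function.extend (fun p : X × X => R p.1 p.2)
    (fun p : X × X => M p.1 p.2) 0) fun x y => (hf.extend_apply 0 (x, y)).symm

theorem transpose_eq_of_mem_boseMesner (hR : ∀ x y, R x y = R y x) {M : Matrix X X ℂ}
    (hM : M ∈ boseMesner R) : M.transpose = M := by
  induction hM using Submodule.span_induction with
  | mem M hM =>
    obtain ⟨i, rfl⟩ := hM
    ext x y
    rw [Matrix.transpose_apply, adjacencyMatrix_apply, adjacencyMatrix_apply, hR]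
  | zero => exact Matrix.transpose_zero
  | add M N _ _ hM hN => rw [Matrix.transpose_add, hM, hN]
  | smul a M _ hM => rw [Matrix.transpose_smul, hM]

theorem conjTranspose_mem_boseMesner (hR : ∀ x y, R x y = R y x) {M : Matrix X X ℂ}
    (hM : M ∈ boseMesner R) : M.conjTranspose ∈ boseMesner R := by
  induction hM using Submodule.span_induction with
  | mem M hM =>
    obtain ⟨i, rfl⟩ := hM
    have : (adjacencyMatrix R i).conjTranspose = adjacencyMatrix R i := by
      ext x y
      rw [Matrix.conjTranspose_apply, adjacencyMatrix_apply, adjacencyMatrix_apply, hR]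
      split_ifs <;> simp
    rw [this]
    exact adjacencyMatrix_mem_boseMesner i
  | zero => simp
  | add M N _ _ hM hN =>
    rw [Matrix.conjTranspose_add]
    exact Submodule.add_mem _ hM hN
  | smul a M _ hM =>
    rw [Matrix.conjTranspose_smul]
    exact Submodule.smul_mem _ _ hM

variable [Fintype X]

theorem mul_mem_boseMesner
    (hmul : ∀ i j, adjacencyMatrix R i * adjacencyMatrix R j ∈ boseMesner R)
    {M N : Matrix X X ℂ} (hM : M ∈ boseMesner R) (hN : N ∈ boseMesner R) :
    M * N ∈ boseMesner R := by
  induction hM using Submodule.span_induction with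
  | mem M hM =>
    obtain ⟨i, rfl⟩ := hM
    induction hN using Submodule.span_induction with
    | mem N hN =>
      obtain ⟨j, rfl⟩ := hN
      exact hmul i j
    | zero => simp
    | add M N _ _ hM hN =>
      rw [Matrix.mul_add]
      exact Submodule.add_mem _ hM hN
    | smul a M _ hM =>
      rw [Matrix.mul_smul]
      exact Submodule.smul_mem _ _ hM
  | zero => simp
  | add M N _ _ hM hN =>
    rw [Matrix.add_mul]
    exact Submodule.add_mem _ hM hN
  | smul a M _ hM =>
    rw [Matrix.smul_mul]
    exact Submodule.smul_mem _ _ hM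

theorem mul_comm_of_mem_boseMesner (hR : ∀ x y, R x y = R y x)
    (hmul : ∀ i j, adjacencyMatrix R i * adjacencyMatrix R j ∈ boseMesner R)
    {M N : Matrix X X ℂ} (hM : M ∈ boseMesner R) (hN : N ∈ boseMesner R) : M * N = N * M := by
  rw [← transpose_eq_of_mem_boseMesner hR (mul_mem_boseMesner hmul hM hN), Matrix.transpose_mul,
    transpose_eq_of_mem_boseMesner hR hM, transpose_eq_of_mem_boseMesner hR hN]

open scoped ComplexOrder in
-- M commutes with its conjugate transpose M*, so M² = 0 makes the square of the Hermitian matrix M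
-- M* vanish. Positivity then gives M M* = 0 and M = 0.
theorem eq_zero_of_mul_self_eq_zero_of_mem_boseMesner (hR : ∀ x y, R x y = R y x)
    (hmul : ∀ i j, adjacencyMatrix R i * adjacencyMatrix R j ∈ boseMesner R)
    {M : Matrix X X ℂ} (hM : M ∈ boseMesner R) (h : M * M = 0) : M = 0 := by
  classical
  have hc := mul_comm_of_mem_boseMesner hR hmul hM (conjTranspose_mem_boseMesner hR hM)
  rw [← Matrix.self_mul_conjTranspose_eq_zero, ← Matrix.self_mul_conjTranspose_eq_zero,
    Matrix.conjTranspose_mul, Matrix.conjTranspose_conjTranspose]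
  calc M * M.conjTranspose * (M * M.conjTranspose)
      = M * (M.conjTranspose * M) * M.conjTranspose := by simp only [Matrix.mul_assoc]
    _ = (M * M) * (M.conjTranspose * M.conjTranspose) := by
        rw [← hc]; simp only [Matrix.mul_assoc]
    _ = 0 := by rw [h, Matrix.zero_mul]

end BoseMesner

/-! ### The nonbinary Johnson scheme is an association scheme -/

/-- Two transpositions suffice: one takes a to a', the next takes the image of b to b'. Each
exchanges elements on which P agrees. Here P will be the property of being the zero symbol. -/
theorem exists_perm_map_pair {K : Type*} {P : K → Prop} {a b a' b' : K}
    (ha : P a ↔ P a') (hb : P b ↔ P b') (hab : a = b ↔ a' = b') :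
    ∃ π : Equiv.Perm K, π a = a' ∧ π b = b' ∧ ∀ c, P (π c) ↔ P c := by
  classical
  have hswap : ∀ u v : K, (P u ↔ P v) → ∀ c, P (Equiv.swap u v c) ↔ P c := by
    intro u v huv c
    rw [Equiv.swap_apply_def]
    split_ifs with h1 h2
    · rw [h1, huv]
    · rw [h2, huv]
    · rfl
  have hb' : P (Equiv.swap a a' b) ↔ P b' := (hswap a a' ha b).trans hb
  refine ⟨(Equiv.swap a a').trans (Equiv.swap (Equiv.swap a a' b) b'), ?_, ?_, fun c => ?_⟩
  · rw [Equiv.trans_apply, Equiv.swap_apply_left]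
    by_cases h : a = b
    · have h' := hab.1 h
      subst h h'
      simp
    · refine Equiv.swap_apply_of_ne_of_ne (fun h' => h ?_) fun h' => h (hab.2 h')
      rw [← Equiv.swap_apply_left a a'] at h'
      exact (Equiv.swap a a').injective (by simpa using h')
  · rw [Equiv.trans_apply, Equiv.swap_apply_left]
  · rw [Equiv.trans_apply]
    exact (hswap _ _ hb' _).trans (hswap _ _ ha c)

/-- The type of the `l`-th position with respect to a pair of vectors. -/
def positionType {n r : ℕ} (x y : Fin n → Fin r) (l : Fin n) : Bool × Bool × Bool :=
  (decide ((x l : ℕ) = 0), decide ((y l : ℕ) = 0), decide (x l = y l))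

theorem card_filter_comp_eq_sum {ι κ : Type*} [Fintype ι] [Fintype κ] [DecidableEq κ]
    (f : ι → κ) (p : κ → Prop) [DecidablePred p] :
    (Finset.univ.filter fun l => p (f l)).card =
      ∑ t, if p t then (Finset.univ.filter fun l => f l = t).card else 0 := by
  simp only [Finset.card_filter]
  have : ∀ t, (if p t then ∑ l, (if f l = t then 1 else 0) else 0) =
      ∑ l, if f l = t then (if p t then 1 else 0) else 0 := by
    intro t
    split_ifs <;> simp
  simp only [this]
  rw [Finset.sum_comm]
  simp

/-- Of the eight types three cannot occur, and the sizes of the other five are determined by e, c, k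
and n. -/
theorem card_positionType_eq {n r k : ℕ} {x y x' y' : NonbinaryJohnsonPoint r n k}
    (he : equalNonzero x.1 y.1 = equalNonzero x'.1 y'.1)
    (hc : commonNonzero x.1 y.1 = commonNonzero x'.1 y'.1) (t : Bool × Bool × Bool) :
    (Finset.univ.filter fun l => positionType x.1 y.1 l = t).card =
      (Finset.univ.filter fun l => positionType x'.1 y'.1 l = t).card := by
  have key : ∀ x y : NonbinaryJohnsonPoint r n k,
      ∃ N : Bool × Bool × Bool → ℕ,
        (∀ t, N t = (Finset.univ.filter fun l => positionType x.1 y.1 l = t).card) ∧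
        N (true, true, false) = 0 ∧ N (true, false, true) = 0 ∧ N (false, true, true) = 0 ∧
        N (false, false, true) = equalNonzero x.1 y.1 ∧
        N (false, false, true) + N (false, false, false) = commonNonzero x.1 y.1 ∧
        N (false, true, false) + commonNonzero x.1 y.1 = k ∧
        N (true, false, false) + commonNonzero x.1 y.1 = k ∧
        N (true, true, true) + N (true, false, false) + N (false, true, false) +
          commonNonzero x.1 y.1 = n := by
    intro x y
    refine ⟨_, fun t => rfl, ?_⟩
    have e1 := card_filter_comp_eq_sum (positionType x.1 y.1)
      (fun t => t.2.2 = true ∧ t.1 = false)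
    have e2 := card_filter_comp_eq_sum (positionType x.1 y.1)
      (fun t => t.1 = false ∧ t.2.1 = false)
    have e3 := card_filter_comp_eq_sum (positionType x.1 y.1) (fun t => t.1 = false)
    have e4 := card_filter_comp_eq_sum (positionType x.1 y.1) (fun t => t.2.1 = false)
    have e5 := card_filter_comp_eq_sum (positionType x.1 y.1) (fun _ => True)
    have z1 : (Finset.univ.filter fun l => positionType x.1 y.1 l = (true, true, false)).card
        = 0 := by
      simp only [positionType, Finset.card_eq_zero, Finset.filter_eq_empty_iff, Prod.mk.injEq,
        decide_eq_true_eq, decide_eq_false_iff_not, Fin.ext_iff]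
      omega
    have z2 : (Finset.univ.filter fun l => positionType x.1 y.1 l = (true, false, true)).card
        = 0 := by
      simp only [positionType, Finset.card_eq_zero, Finset.filter_eq_empty_iff, Prod.mk.injEq,
        decide_eq_true_eq, decide_eq_false_iff_not, Fin.ext_iff]
      omega
    have z3 : (Finset.univ.filter fun l => positionType x.1 y.1 l = (false, true, true)).card
        = 0 := by
      simp only [positionType, Finset.card_eq_zero, Finset.filter_eq_empty_iff, Prod.mk.injEq,
        decide_eq_true_eq, decide_eq_false_iff_not, Fin.ext_iff]
      omega
    have d1 : (Finset.univ.filter fun l => (positionType x.1 y.1 l).2.2 = true ∧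
        (positionType x.1 y.1 l).1 = false).card = equalNonzero x.1 y.1 := by
      simp [positionType, equalNonzero]
    have d2 : (Finset.univ.filter fun l => (positionType x.1 y.1 l).1 = false ∧
        (positionType x.1 y.1 l).2.1 = false).card = commonNonzero x.1 y.1 := by
      simp [positionType, commonNonzero]
    have d3 : (Finset.univ.filter fun l => (positionType x.1 y.1 l).1 = false).card = k := by
      simpa [positionType, nonzeroPositions] using x.2
    have d4 : (Finset.univ.filter fun l => (positionType x.1 y.1 l).2.1 = false).card = k := by
      simpa [positionType, nonzeroPositions] using y.2
    have d5 : (Finset.univ.filter fun _ : Fin n => True).card = n := by simp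
    rw [d1] at e1
    rw [d2] at e2
    rw [d3] at e3
    rw [d4] at e4
    rw [d5] at e5
    simp only [Fintype.sum_prod_type, Fintype.sum_bool, and_true, and_false,
      if_true, if_false, Bool.true_eq_false, Bool.false_eq_true] at e1 e2 e3 e4 e5
    refine ⟨z1, z2, z3, ?_⟩
    omega
  obtain ⟨N, hN, h⟩ := key x y
  obtain ⟨N', hN', h'⟩ := key x' y'
  rw [← hN, ← hN']
  obtain ⟨b1, b2, b3⟩ := t
  cases b1 <;> cases b2 <;> cases b3 <;> omega

/-- A bijection of positions matching types moves one pair onto the other up to the symbols; a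
permutation of the symbols at each position, respecting zero, does the rest. Transitivity on each
relation makes the entries of products of adjacency matrices depend only on the relation. -/
theorem exists_isometry {n r k : ℕ} {x y x' y' : NonbinaryJohnsonPoint r n k}
    (he : equalNonzero x.1 y.1 = equalNonzero x'.1 y'.1)
    (hc : commonNonzero x.1 y.1 = commonNonzero x'.1 y'.1) :
    ∃ Φ : NonbinaryJohnsonPoint r n k ≃ NonbinaryJohnsonPoint r n k, Φ x = x' ∧ Φ y = y' ∧
      ∀ z w, equalNonzero (Φ z).1 (Φ w).1 = equalNonzero z.1 w.1 ∧
        commonNonzero (Φ z).1 (Φ w).1 = commonNonzero z.1 w.1 := by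
  have hfib : ∀ t, Nonempty ({l // positionType x.1 y.1 l = t} ≃
      {l // positionType x'.1 y'.1 l = t}) := by
    intro t
    refine ⟨Fintype.equivOfCardEq ?_⟩
    rw [Fintype.card_subtype, Fintype.card_subtype]
    exact card_positionType_eq he hc t
  let σ : Fin n ≃ Fin n := Equiv.ofFiberEquiv fun t => (hfib t).some
  have hσ : ∀ l, positionType x'.1 y'.1 (σ l) = positionType x.1 y.1 l :=
    Equiv.ofFiberEquiv_map _
  have hπ : ∀ l, ∃ π : Equiv.Perm (Fin r), π (x.1 l) = x'.1 (σ l) ∧ π (y.1 l) = y'.1 (σ l) ∧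
      ∀ c, (π c : ℕ) = 0 ↔ (c : ℕ) = 0 := by
    intro l
    have := hσ l
    simp only [positionType, Prod.mk.injEq, decide_eq_decide] at this
    exact exists_perm_map_pair (P := fun c : Fin r => (c : ℕ) = 0) this.1.symm this.2.1.symm
      this.2.2.symm
  choose π hπx hπy hπ0 using hπ
  let Φ : (Fin n → Fin r) ≃ (Fin n → Fin r) := Equiv.piCongr σ π
  have hΦ : ∀ z l, Φ z (σ l) = π l (z l) := fun z l =>
    Equiv.piCongr_apply_apply (W := fun _ => Fin r) (Z := fun _ => Fin r) σ π z l
  have hcard : ∀ z, (nonzeroPositions z).card = (nonzeroPositions (Φ z)).card := by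
    intro z
    refine Finset.card_equiv σ fun l => ?_
    simp [nonzeroPositions, hΦ, hπ0]
  refine ⟨Φ.subtypeEquiv fun z => by rw [hcard z], ?_, ?_, fun z w => ⟨?_, ?_⟩⟩
  · ext l : 2
    obtain ⟨l, rfl⟩ := σ.surjective l
    exact (hΦ _ _).trans (hπx l)
  · ext l : 2
    obtain ⟨l, rfl⟩ := σ.surjective l
    exact (hΦ _ _).trans (hπy l)
  · symm
    refine Finset.card_equiv σ fun l => ?_
    simp [hΦ, hπ0]
  · symm
    refine Finset.card_equiv σ fun l => ?_
    simp [hΦ, hπ0]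

theorem equalNonzero_comm {n r : ℕ} (x y : Fin n → Fin r) :
    equalNonzero x y = equalNonzero y x := by
  unfold equalNonzero
  congr 1
  ext l
  simp only [Finset.mem_filter, Finset.mem_univ, true_and]
  constructor <;> rintro ⟨h1, h2⟩ <;> exact ⟨h1.symm, h1 ▸ h2⟩

theorem commonNonzero_comm {n r : ℕ} (x y : Fin n → Fin r) :
    commonNonzero x y = commonNonzero y x := by
  rw [commonNonzero_eq, commonNonzero_eq, Finset.inter_comm]

section Scheme

variable {r n k : ℕ}

theorem nonbinaryJohnson_eq_nonbinaryJohnson_iff (x y x' y' : NonbinaryJohnsonPoint r n k) :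
    nonbinaryJohnson r n k x y = nonbinaryJohnson r n k x' y' ↔
      equalNonzero x.1 y.1 = equalNonzero x'.1 y'.1 ∧
        commonNonzero x.1 y.1 = commonNonzero x'.1 y'.1 := by
  have h := (nonbinaryJohnson_eq_iff x' y' _).1 rfl
  rw [nonbinaryJohnson_eq_iff]
  omega

theorem nonbinaryJohnson_comm (x y : NonbinaryJohnsonPoint r n k) :
    nonbinaryJohnson r n k x y = nonbinaryJohnson r n k y x :=
  (nonbinaryJohnson_eq_nonbinaryJohnson_iff x y y x).2
    ⟨equalNonzero_comm _ _, commonNonzero_comm _ _⟩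

theorem adjacencyMatrix_nonbinaryJohnson_mul_mem (i j : nonbinaryJohnsonDomain n k) :
    adjacencyMatrix (nonbinaryJohnson r n k) i * adjacencyMatrix (nonbinaryJohnson r n k) j ∈
      boseMesner (nonbinaryJohnson r n k) := by
  refine mem_boseMesner_of_const fun x y x' y' h => ?_
  rw [nonbinaryJohnson_eq_nonbinaryJohnson_iff] at h
  obtain ⟨Φ, hx, hy, hΦ⟩ := exists_isometry h.1 h.2
  have hR : ∀ z w, nonbinaryJohnson r n k (Φ z) (Φ w) = nonbinaryJohnson r n k z w := fun z w =>
    (nonbinaryJohnson_eq_nonbinaryJohnson_iff _ _ _ _).2 (hΦ z w)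
  rw [Matrix.mul_apply, Matrix.mul_apply]
  refine Fintype.sum_equiv Φ _ _ fun z => ?_
  simp only [adjacencyMatrix_apply, ← hx, ← hy, hR]

theorem equalNonzero_eq_iff (x y : NonbinaryJohnsonPoint r n k) :
    equalNonzero x.1 y.1 = k ↔ x = y := by
  constructor
  · intro h
    have hx : (Finset.univ.filter fun i => x.1 i = y.1 i ∧ (x.1 i : ℕ) ≠ 0) =
        nonzeroPositions x.1 := by
      refine Finset.eq_of_subset_of_card_le (fun i hi => ?_) (by rw [x.2]; exact h.ge)
      simp only [nonzeroPositions, Finset.mem_filter] at hi ⊢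
      exact ⟨hi.1, hi.2.2⟩
    have hy : (Finset.univ.filter fun i => x.1 i = y.1 i ∧ (x.1 i : ℕ) ≠ 0) =
        nonzeroPositions y.1 := by
      refine Finset.eq_of_subset_of_card_le (fun i hi => ?_) (by rw [y.2]; exact h.ge)
      simp only [nonzeroPositions, Finset.mem_filter] at hi ⊢
      exact ⟨hi.1, hi.2.1 ▸ hi.2.2⟩
    ext i : 2
    have h1 := Finset.ext_iff.1 hx i
    have h2 := Finset.ext_iff.1 hy i
    simp only [nonzeroPositions, Finset.mem_filter, Finset.mem_univ, true_and] at h1 h2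
    by_cases h0 : (x.1 i : ℕ) = 0
    · by_cases h0' : (y.1 i : ℕ) = 0
      · exact Fin.ext (h0.trans h0'.symm)
      · exact (h2.2 h0').1
    · exact (h1.2 h0).1
  · rintro rfl
    simpa [equalNonzero, nonzeroPositions] using x.2

theorem isCommAssocScheme_nonbinaryJohnson
    (hsurj : ∀ α, ∃ x y, nonbinaryJohnson r n k x y = α) :
    IsCommAssocScheme (nonbinaryJohnson r n k) := by
  refine ⟨hsurj, ⟨⟨0, by simp [nonbinaryJohnsonDomain]⟩, ?_⟩, fun i => ⟨i, ?_⟩,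
    adjacencyMatrix_nonbinaryJohnson_mul_mem, fun i j => ?_⟩
  · ext x y
    rw [adjacencyMatrix_apply, Matrix.one_apply]
    congr 1
    rw [← equalNonzero_eq_iff, nonbinaryJohnson_eq_iff]
    have h1 := commonNonzero_le x y
    have h2 := equalNonzero_le_commonNonzero x.1 y.1
    simp only [Finsupp.coe_zero, Pi.zero_apply, eq_iff_iff]
    omega
  · exact transpose_eq_of_mem_boseMesner nonbinaryJohnson_comm
      (adjacencyMatrix_mem_boseMesner i)
  · exact mul_comm_of_mem_boseMesner nonbinaryJohnson_comm
      adjacencyMatrix_nonbinaryJohnson_mul_mem (adjacencyMatrix_mem_boseMesner i)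
      (adjacencyMatrix_mem_boseMesner j)

end Scheme

/-! ### Alternating sums over cubes of bits -/

/-- The sign `(-1) ^ #{i | u_i = 1}` of a vector of bits. -/
def bitSign {ι : Type*} [Fintype ι] (u : ι → Bool) : ℂ := ∏ i, if u i then -1 else 1

theorem bitSign_update {ι : Type*} [Fintype ι] [DecidableEq ι] (u : ι → Bool) (i : ι) :
    bitSign (Function.update u i (!u i)) = -bitSign u := by
  unfold bitSign
  rw [← Finset.mul_prod_erase _ _ (Finset.mem_univ i),
    ← Finset.mul_prod_erase _ _ (Finset.mem_univ i), ← neg_mul]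
  congr 1
  · rw [Function.update_self]
    cases u i <;> simp
  · refine Finset.prod_congr rfl fun j hj => ?_
    rw [Function.update_of_ne (Finset.ne_of_mem_erase hj)]

theorem bitSign_ne_zero {ι : Type*} [Fintype ι] (u : ι → Bool) : bitSign u ≠ 0 := by
  refine Finset.prod_ne_zero_iff.2 fun i _ => ?_
  split_ifs <;> simp

theorem sum_bitSign_mul_eq_zero {ι : Type*} [Fintype ι] [DecidableEq ι] (i : ι)
    (f : (ι → Bool) → ℂ) (hf : ∀ u, f (Function.update u i (!u i)) = f u) :
    ∑ u, bitSign u * f u = 0 := by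
  refine Finset.sum_involution (fun u _ => Function.update u i (!u i)) ?_ ?_ ?_ ?_
  · intro u _
    rw [hf, bitSign_update]
    ring
  · intro u _ _ h
    have := congrFun h i
    rw [Function.update_self] at this
    cases hu : u i <;> simp [hu] at this
  · exact fun u _ => Finset.mem_univ _
  · intro u _
    simp

/-- An alternating sum over bits of a product of few functions of single bits vanishes. -/
theorem sum_bitSign_mul_pow_mul_pow_eq_zero {a b p q : ℕ} (hpq : ¬(a ≤ p ∧ a + b ≤ p + q))
    (κ κ' : ℂ) (ε : Fin a ⊕ Fin b → Bool → ℂ) (γ : Fin b → Bool → ℂ) :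
    ∑ u : Fin a ⊕ Fin b → Bool, bitSign u *
      ((κ + ∑ i, ε i (u i)) ^ p * (κ' + ∑ j, γ j (u (Sum.inr j))) ^ q) = 0 := by
  -- The value `none` selects the constant term, so a power of the sum becomes a sum over choice
  -- functions.
  let F : Option (Fin a ⊕ Fin b) → (Fin a ⊕ Fin b → Bool) → ℂ :=
    fun o u => o.elim κ fun i => ε i (u i)
  let G : Option (Fin b) → (Fin a ⊕ Fin b → Bool) → ℂ :=
    fun o u => o.elim κ' fun j => γ j (u (Sum.inr j))
  have hF : ∀ u, (κ + ∑ i, ε i (u i)) ^ p = ∑ P : Fin p → Option (Fin a ⊕ Fin b),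
      ∏ s, F (P s) u := by
    intro u
    rw [← Fintype.sum_pow (fun o => F o u), Fintype.sum_option]
    rfl
  have hG : ∀ u : Fin a ⊕ Fin b → Bool, (κ' + ∑ j, γ j (u (Sum.inr j))) ^ q =
      ∑ Q : Fin q → Option (Fin b), ∏ s, G (Q s) u := by
    intro u
    rw [← Fintype.sum_pow (fun o => G o u), Fintype.sum_option]
    rfl
  simp only [hF, hG]
  simp only [Finset.sum_mul_sum]
  simp only [Finset.mul_sum]
  rw [Finset.sum_comm]
  refine Finset.sum_eq_zero fun P _ => ?_
  rw [Finset.sum_comm]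
  refine Finset.sum_eq_zero fun Q _ => ?_
  -- Some bit is used by no factor. Otherwise the colour bits, reachable only through P, inject into
  -- Fin p, and all bits inject into Fin p ⊕ Fin q, contradicting `hpq`.
  have : ∃ i, (∀ s, P s ≠ some i) ∧ ∀ s j, Q s = some j → Sum.inr j ≠ i := by
    by_contra! h
    refine hpq ⟨?_, ?_⟩
    · have h1 : ∀ i : Fin a, ∃ s, P s = some (Sum.inl i) := by
        intro i
        by_contra! h'
        obtain ⟨s, j, -, hj⟩ := h (Sum.inl i) h'
        exact absurd hj (by simp)
      choose f hf using h1
      have hinj : Function.Injective f := by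
        intro i j hij
        have := hf i
        rw [hij, hf j] at this
        simpa using this.symm
      simpa using Fintype.card_le_of_injective f hinj
    · have h1 : ∀ i : Fin a ⊕ Fin b, ∃ s : Fin p ⊕ Fin q,
          s.elim (fun s => P s = some i) fun s => ∃ j, Q s = some j ∧ Sum.inr j = i := by
        intro i
        by_cases h' : ∃ s, P s = some i
        · obtain ⟨s, hs⟩ := h'
          exact ⟨Sum.inl s, hs⟩
        · push Not at h'
          obtain ⟨s, j, hs, hj⟩ := h i h'
          exact ⟨Sum.inr s, j, hs, hj⟩
      choose f hf using h1
      have hinj : Function.Injective f := by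
        intro i j hij
        have h1 := hf i
        have h2 := hf j
        rw [← hij] at h2
        cases hfi : f i with
        | inl s =>
          rw [hfi] at h1 h2
          simp only [Sum.elim_inl] at h1 h2
          simpa [h1] using h2
        | inr s =>
          rw [hfi] at h1 h2
          obtain ⟨c, hc, rfl⟩ := h1
          obtain ⟨d, hd, rfl⟩ := h2
          rw [hc] at hd
          rw [Option.some.inj hd]
      simpa using Fintype.card_le_of_injective f hinj
  obtain ⟨i, hP, hQ⟩ := this
  refine sum_bitSign_mul_eq_zero i _ fun u => ?_
  congr 1
  · refine Finset.prod_congr rfl fun s _ => ?_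
    cases hs : P s with
    | none => rfl
    | some j =>
      have hj : j ≠ i := fun h => hP s (h ▸ hs)
      simp only [F, Option.elim_some]
      rw [Function.update_of_ne hj]
  · refine Finset.prod_congr rfl fun s _ => ?_
    cases hs : Q s with
    | none => rfl
    | some j =>
      simp only [G, Option.elim_some]
      rw [Function.update_of_ne (hQ s j hs)]

/-! ### Cubes of points of the nonbinary Johnson scheme -/

/-- The vector that carries `a` independent colour choices, `b` independent choices between two
positions, `p` fixed nonzero entries, and `q` fixed zero entries. -/
def cubeVector {a b p q r : ℕ} (hr : 2 < r) (u : Fin a ⊕ Fin b → Bool) :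
    Fin a ⊕ ((Fin b ⊕ Fin b) ⊕ (Fin p ⊕ Fin q)) → Fin r :=
  Sum.elim (fun i => if u (Sum.inl i) then ⟨2, hr⟩ else ⟨1, by omega⟩)
    (Sum.elim
      (Sum.elim (fun j => if u (Sum.inr j) then ⟨0, by omega⟩ else ⟨1, by omega⟩)
        (fun j => if u (Sum.inr j) then ⟨1, by omega⟩ else ⟨0, by omega⟩))
      (Sum.elim (fun _ => ⟨1, by omega⟩) (fun _ => ⟨0, by omega⟩)))

/-- The n positions split into a colour positions, b pairs with one nonzero entry each, k - a - b
constant ones and n - k - b constant zeros; the conditions defining the domain make these sizes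
possible. Flipping a bit changes only its own position or pair, which gives the sums of single-bit
functions. -/
theorem exists_cube {r n k a b : ℕ} (hr : 2 < r) (hkn : k < n) (hab : a + b ≤ k)
    (hb : b ≤ n - k) :
    ∃ x : (Fin a ⊕ Fin b → Bool) → NonbinaryJohnsonPoint r n k,
      (∀ y : NonbinaryJohnsonPoint r n k, ∃ (κ : ℂ) (ε : Fin a ⊕ Fin b → Bool → ℂ),
        ∀ u, (equalNonzero y.1 (x u).1 : ℂ) = κ + ∑ i, ε i (u i)) ∧
      (∀ y : NonbinaryJohnsonPoint r n k, ∃ (κ : ℂ) (γ : Fin b → Bool → ℂ),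
        ∀ u, (commonNonzero y.1 (x u).1 : ℂ) = κ + ∑ j, γ j (u (Sum.inr j))) ∧
      (∀ u, equalNonzero (x fun _ => false).1 (x u).1 +
        ((∑ i, if u (Sum.inl i) then 1 else 0) + ∑ j, if u (Sum.inr j) then 1 else 0) = k) ∧
      ∀ u, commonNonzero (x fun _ => false).1 (x u).1 +
        (∑ j, if u (Sum.inr j) then 1 else 0) = k := by
  have hcard : Fintype.card (Fin n) = Fintype.card
      (Fin a ⊕ ((Fin b ⊕ Fin b) ⊕ (Fin (k - a - b) ⊕ Fin (n - k - b)))) := by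
    simp only [Fintype.card_fin, Fintype.card_sum]
    omega
  let ρ := Fintype.equivOfCardEq hcard
  have hsum : ∀ {A : Type} [AddCommMonoid A] (f : Fin n → A), ∑ l, f l =
      ∑ i, f (ρ.symm (Sum.inl i)) + ((∑ j, f (ρ.symm (Sum.inr (Sum.inl (Sum.inl j)))) +
        ∑ j, f (ρ.symm (Sum.inr (Sum.inl (Sum.inr j))))) +
        (∑ j, f (ρ.symm (Sum.inr (Sum.inr (Sum.inl j)))) +
        ∑ j, f (ρ.symm (Sum.inr (Sum.inr (Sum.inr j)))))) := by
    intro A _ f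
    rw [← Equiv.sum_comp ρ.symm f]
    simp only [Fintype.sum_sum_type]
  have hwt : ∀ u : Fin a ⊕ Fin b → Bool,
      (nonzeroPositions fun l => cubeVector hr u (ρ l)).card = k := by
    intro u
    rw [nonzeroPositions, Finset.card_filter, hsum]
    simp only [Equiv.apply_symm_apply, cubeVector, Sum.elim_inl, Sum.elim_inr]
    have h1 : ∀ i : Fin a, (if (((if u (Sum.inl i) then ⟨2, hr⟩ else ⟨1, by omega⟩ : Fin r)) : ℕ)
        ≠ 0 then 1 else 0) = 1 := by
      intro i
      cases u (Sum.inl i) <;> simp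
    have h2 : ∀ j : Fin b,
        (if (((if u (Sum.inr j) then ⟨0, by omega⟩ else ⟨1, by omega⟩ : Fin r)) : ℕ)
        ≠ 0 then 1 else 0) +
        (if (((if u (Sum.inr j) then ⟨1, by omega⟩ else ⟨0, by omega⟩ : Fin r)) : ℕ)
        ≠ 0 then 1 else 0) = 1 := by
      intro i
      cases u (Sum.inr i) <;> simp
    rw [← Finset.sum_add_distrib]
    simp only [h1, h2]
    simp
    omega
  refine ⟨fun u => ⟨fun l => cubeVector hr u (ρ l), hwt u⟩, fun y => ?_, fun y => ?_,
    fun u => ?_, fun u => ?_⟩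
  · let φ : Fin r → Fin r → ℂ := fun s t => if s = t ∧ (s : ℕ) ≠ 0 then 1 else 0
    let y' := fun ν => y.1 (ρ.symm ν)
    refine ⟨∑ j, φ (y' (Sum.inr (Sum.inr (Sum.inl j)))) ⟨1, by omega⟩ +
        ∑ j, φ (y' (Sum.inr (Sum.inr (Sum.inr j)))) ⟨0, by omega⟩,
      Sum.elim (fun i β => φ (y' (Sum.inl i)) (if β then ⟨2, hr⟩ else ⟨1, by omega⟩))
        (fun j β => φ (y' (Sum.inr (Sum.inl (Sum.inl j)))) (if β then ⟨0, by omega⟩ else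
          ⟨1, by omega⟩) + φ (y' (Sum.inr (Sum.inl (Sum.inr j)))) (if β then ⟨1, by omega⟩ else
          ⟨0, by omega⟩)), fun u => ?_⟩
    rw [equalNonzero, Finset.card_filter, Nat.cast_sum, hsum, Fintype.sum_sum_type]
    simp only [Equiv.apply_symm_apply, cubeVector, Sum.elim_inl, Sum.elim_inr, φ, y',
      Finset.sum_add_distrib, Nat.cast_ite, Nat.cast_one, Nat.cast_zero]
    ring
  · let φ : Fin r → Fin r → ℂ := fun s t => if (s : ℕ) ≠ 0 ∧ (t : ℕ) ≠ 0 then 1 else 0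
    let y' := fun ν => y.1 (ρ.symm ν)
    refine ⟨∑ i, φ (y' (Sum.inl i)) ⟨1, by omega⟩ +
        (∑ j, φ (y' (Sum.inr (Sum.inr (Sum.inl j)))) ⟨1, by omega⟩ +
        ∑ j, φ (y' (Sum.inr (Sum.inr (Sum.inr j)))) ⟨0, by omega⟩),
      (fun j β => φ (y' (Sum.inr (Sum.inl (Sum.inl j)))) (if β then ⟨0, by omega⟩ else
          ⟨1, by omega⟩) + φ (y' (Sum.inr (Sum.inl (Sum.inr j)))) (if β then ⟨1, by omega⟩ else
          ⟨0, by omega⟩)), fun u => ?_⟩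
    -- Both colours 1 and 2 are nonzero, so c does not see the colour bits.
    have h1 : ∀ i : Fin a, φ (y' (Sum.inl i)) (if u (Sum.inl i) then ⟨2, hr⟩ else ⟨1, by omega⟩) =
        φ (y' (Sum.inl i)) ⟨1, by omega⟩ := by
      intro i
      cases u (Sum.inl i) <;> simp [φ]
    rw [← Finset.sum_congr rfl fun i _ => h1 i]
    rw [commonNonzero, Finset.card_filter, Nat.cast_sum, hsum]
    simp only [Equiv.apply_symm_apply, cubeVector, Sum.elim_inl, Sum.elim_inr, φ, y',
      Finset.sum_add_distrib, Nat.cast_ite, Nat.cast_one, Nat.cast_zero]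
    ring
  · rw [equalNonzero, Finset.card_filter, hsum]
    simp only [Equiv.apply_symm_apply, cubeVector, Sum.elim_inl, Sum.elim_inr,
      Bool.false_eq_true, if_false]
    have h1 : ∀ i : Fin a, (if (⟨1, by omega⟩ : Fin r) =
        (if u (Sum.inl i) then ⟨2, hr⟩ else ⟨1, by omega⟩) ∧ (1 : ℕ) ≠ 0 then 1 else 0) =
        if u (Sum.inl i) then 0 else 1 := by
      intro i
      cases u (Sum.inl i) <;> simp
    have h2 : ∀ j : Fin b, (if (⟨1, by omega⟩ : Fin r) =
        (if u (Sum.inr j) then ⟨0, by omega⟩ else ⟨1, by omega⟩) ∧ (1 : ℕ) ≠ 0 then 1 else 0) =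
        if u (Sum.inr j) then 0 else 1 := by
      intro j
      cases u (Sum.inr j) <;> simp
    have h3 : (∑ i : Fin a, if u (Sum.inl i) then 0 else 1) +
        (∑ i : Fin a, if u (Sum.inl i) then 1 else 0) = a := by
      rw [← Finset.sum_add_distrib, Finset.sum_congr rfl fun i _ =>
        show (if u (Sum.inl i) then 0 else 1) + (if u (Sum.inl i) then 1 else 0) = 1 by
          cases u (Sum.inl i) <;> simp]
      simp
    have h4 : (∑ i : Fin b, if u (Sum.inr i) then 0 else 1) +
        (∑ i : Fin b, if u (Sum.inr i) then 1 else 0) = b := by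
      rw [← Finset.sum_add_distrib, Finset.sum_congr rfl fun i _ =>
        show (if u (Sum.inr i) then 0 else 1) + (if u (Sum.inr i) then 1 else 0) = 1 by
          cases u (Sum.inr i) <;> simp]
      simp
    simp only [h1, h2]
    simp only [ne_eq, not_true_eq_false, and_false, if_false, Finset.sum_const_zero,
      one_ne_zero, not_false_eq_true, and_true, if_true, Finset.sum_const, Finset.card_univ,
      Fintype.card_fin, smul_eq_mul, mul_one]
    omega
  · rw [commonNonzero, Finset.card_filter, hsum]
    simp only [Equiv.apply_symm_apply, cubeVector, Sum.elim_inl, Sum.elim_inr,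
      Bool.false_eq_true, if_false]
    have h1 : ∀ i : Fin a, (if (1 : ℕ) ≠ 0 ∧
        (((if u (Sum.inl i) then ⟨2, hr⟩ else ⟨1, by omega⟩ : Fin r)) : ℕ) ≠ 0 then 1 else 0) =
        1 := by
      intro i
      cases u (Sum.inl i) <;> simp
    have h2 : ∀ j : Fin b, (if (1 : ℕ) ≠ 0 ∧
        (((if u (Sum.inr j) then ⟨0, by omega⟩ else ⟨1, by omega⟩ : Fin r)) : ℕ) ≠ 0
        then 1 else 0) = if u (Sum.inr j) then 0 else 1 := by
      intro j
      cases u (Sum.inr j) <;> simp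
    have h4 : (∑ i : Fin b, if u (Sum.inr i) then 0 else 1) +
        (∑ i : Fin b, if u (Sum.inr i) then 1 else 0) = b := by
      rw [← Finset.sum_add_distrib, Finset.sum_congr rfl fun i _ =>
        show (if u (Sum.inr i) then 0 else 1) + (if u (Sum.inr i) then 1 else 0) = 1 by
          cases u (Sum.inr i) <;> simp]
      simp
    simp only [h1, h2]
    simp only [ne_eq, not_true_eq_false, false_and, if_false, Finset.sum_const_zero,
      one_ne_zero, not_false_eq_true, and_true, and_false, if_true, Finset.sum_const,
      Finset.card_univ, Fintype.card_fin, smul_eq_mul, mul_one]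
    omega

/-! ### The functions `e` and `c` as coordinates on the nonbinary Johnson scheme -/

/-- Ties in total degree are broken by coordinate 0, the exponent of e, which counts the colour
bits. This is the form required by `sum_bitSign_mul_pow_mul_pow_eq_zero`. -/
theorem toSyn_degLex_lt_imp {α β : Fin 2 →₀ ℕ}
    (h : (MonomialOrder.degLex (σ := Fin 2)).toSyn α < MonomialOrder.degLex.toSyn β) :
    ¬(β 0 ≤ α 0 ∧ β 0 + β 1 ≤ α 0 + α 1) := by
  rw [MonomialOrder.degLex_lt_iff, Finsupp.DegLex.lt_iff] at h
  simp only [ofDegLex_toDegLex, Finsupp.degree_eq_sum, Fin.sum_univ_two] at h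
  rintro ⟨h0, h1⟩
  rcases h with h | ⟨h, h'⟩
  · omega
  · rw [Finsupp.Lex.lt_iff] at h'
    obtain ⟨i, hi, hlt⟩ := h'
    simp only [ofLex_toLex] at hi hlt
    fin_cases i
    · simp at hlt
      omega
    · have := hi 0 (by simp)
      simp at hlt
      omega

/-- The functions `e` and `c` on pairs of points. -/
def johnsonCoord (r n k : ℕ) :
    Fin 2 → NonbinaryJohnsonPoint r n k → NonbinaryJohnsonPoint r n k → ℂ :=
  ![fun x y => equalNonzero x.1 y.1, fun x y => commonNonzero x.1 y.1]

section Coord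

variable {r n k : ℕ}

theorem monomialValue_johnsonCoord_apply (α : Fin 2 →₀ ℕ) (x y : NonbinaryJohnsonPoint r n k) :
    monomialValue (johnsonCoord r n k) α x y =
      (equalNonzero x.1 y.1 : ℂ) ^ α 0 * (commonNonzero x.1 y.1 : ℂ) ^ α 1 := by
  simp [monomialValue, johnsonCoord, Fin.prod_univ_two]

theorem eq_smul_unitIndex_add (α : Fin 2 →₀ ℕ) :
    α = α 0 • unitIndex 0 + α 1 • unitIndex 1 := by
  ext i
  fin_cases i <;> simp [unitIndex]

/-- The product `∏_{t < α 0} (e - f t) ∏_{t < α 1} (c - g t)`. -/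
noncomputable def shiftedMonomial (f g : ℕ → ℂ) (α : Fin 2 →₀ ℕ) :
    NonbinaryJohnsonPoint r n k → NonbinaryJohnsonPoint r n k → ℂ :=
  (∏ t ∈ Finset.range (α 0), (johnsonCoord r n k 0 - algebraMap ℂ _ (f t))) *
    ∏ t ∈ Finset.range (α 1), (johnsonCoord r n k 1 - algebraMap ℂ _ (g t))

theorem shiftedMonomial_apply (f g : ℕ → ℂ) (α : Fin 2 →₀ ℕ)
    (x y : NonbinaryJohnsonPoint r n k) :
    shiftedMonomial f g α x y =
      (∏ t ∈ Finset.range (α 0), ((equalNonzero x.1 y.1 : ℂ) - f t)) *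
        ∏ t ∈ Finset.range (α 1), ((commonNonzero x.1 y.1 : ℂ) - g t) := by
  simp [shiftedMonomial, johnsonCoord, Finset.prod_apply]

theorem shiftedMonomial_sub_mem (m : MonomialOrder (Fin 2)) (f g : ℕ → ℂ) (α : Fin 2 →₀ ℕ) :
    shiftedMonomial f g α - monomialValue (johnsonCoord r n k) α ∈
      spanLT m (johnsonCoord r n k) α := by
  have := sub_monomialValue_mul_mem
    (prod_sub_algebraMap_sub_monomialValue_mem (m := m) (g := johnsonCoord r n k) 0 f (α 0))
    (prod_sub_algebraMap_sub_monomialValue_mem (m := m) (g := johnsonCoord r n k) 1 g (α 1))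
  rwa [← eq_smul_unitIndex_add] at this

/-- The product of the e - t for t < γ 0 and the c - (k - t) for t < γ 1 vanishes identically. At a
pair with c = k - j, a c-factor is zero if j < γ 1. Otherwise γ 1 ≤ j ≤ min k (n - k), so γ outside
the domain forces γ 0 + γ 1 > k, whence e ≤ k - j < γ 0 and an e-factor is zero. -/
theorem monomialValue_johnsonCoord_mem_spanLT (m : MonomialOrder (Fin 2)) {γ : Fin 2 →₀ ℕ}
    (hγ : γ ∉ nonbinaryJohnsonDomain n k) :
    monomialValue (johnsonCoord r n k) γ ∈ spanLT m (johnsonCoord r n k) γ := by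
  have h := shiftedMonomial_sub_mem (r := r) (n := n) (k := k) m (fun t => (t : ℂ))
    (fun t => (k : ℂ) - t) γ
  have h0 : shiftedMonomial (r := r) (n := n) (k := k) (fun t => (t : ℂ))
      (fun t => (k : ℂ) - t) γ = 0 := by
    ext x y
    rw [shiftedMonomial_apply, Pi.zero_apply, Pi.zero_apply, mul_eq_zero]
    have hxy := pairIndex_mem_nonbinaryJohnsonDomain x y
    simp only [nonbinaryJohnsonDomain, pairIndex, Set.mem_ofPred_eq,
      Finsupp.equivFunOnFinite_symm_apply_apply, Matrix.cons_val_zero,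
      Matrix.cons_val_one] at hxy hγ
    have h1 := commonNonzero_le x y
    have h2 := equalNonzero_le_commonNonzero x.1 y.1
    by_cases hj : k - commonNonzero x.1 y.1 < γ 1
    · right
      refine Finset.prod_eq_zero (Finset.mem_range.2 hj) ?_
      rw [Nat.cast_sub h1]
      ring
    · left
      refine Finset.prod_eq_zero (i := equalNonzero x.1 y.1) (Finset.mem_range.2 ?_) (sub_self _)
      omega
  rw [h0, zero_sub] at h
  exact (Submodule.neg_mem_iff _).1 h

theorem exists_testVector (hr : 2 < r) (hkn : k < n) {β : Fin 2 →₀ ℕ}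
    (hβ : β ∈ nonbinaryJohnsonDomain n k) :
    ∃ t : NonbinaryJohnsonPoint r n k → ℂ,
      (∀ γ, (MonomialOrder.degLex (σ := Fin 2)).toSyn γ < MonomialOrder.degLex.toSyn β →
        (Matrix.of (monomialValue (johnsonCoord r n k) γ)).mulVec t = 0) ∧
      (Matrix.of (monomialValue (johnsonCoord r n k) β)).mulVec t ≠ 0 := by
  have hβ' := hβ
  simp only [nonbinaryJohnsonDomain, Set.mem_ofPred_eq] at hβ'
  obtain ⟨x, he, hc, he', hc'⟩ := exists_cube (r := r) (a := β 0) (b := β 1) hr hkn hβ'.1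
    (by omega)
  let t : NonbinaryJohnsonPoint r n k → ℂ := ∑ u, bitSign u • Pi.single (x u) (1 : ℂ)
  have ht : ∀ (f : NonbinaryJohnsonPoint r n k → NonbinaryJohnsonPoint r n k → ℂ) y,
      (Matrix.of f).mulVec t y = ∑ u, bitSign u * f y (x u) := by
    intro f y
    rw [Matrix.mulVec_sum, Finset.sum_apply]
    refine Finset.sum_congr rfl fun u _ => ?_
    rw [Matrix.mulVec_smul, Matrix.mulVec_single_one]
    rfl
  have hzero : ∀ γ, (MonomialOrder.degLex (σ := Fin 2)).toSyn γ < MonomialOrder.degLex.toSyn β →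
      (Matrix.of (monomialValue (johnsonCoord r n k) γ)).mulVec t = 0 := by
    intro γ hγ
    ext y
    obtain ⟨κ, ε, h1⟩ := he y
    obtain ⟨κ', δ, h2⟩ := hc y
    rw [ht]
    simp only [monomialValue_johnsonCoord_apply, h1, h2]
    exact sum_bitSign_mul_pow_mul_pow_eq_zero (toSyn_degLex_lt_imp hγ) κ κ' ε δ
  refine ⟨t, hzero, fun h => ?_⟩
  let Λ : (NonbinaryJohnsonPoint r n k → NonbinaryJohnsonPoint r n k → ℂ) →ₗ[ℂ]
      (NonbinaryJohnsonPoint r n k → ℂ) :=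
    { toFun := fun f => (Matrix.of f).mulVec t
      map_add' := fun f g => Matrix.add_mulVec (Matrix.of f) (Matrix.of g) t
      map_smul' := fun a f => Matrix.smul_mulVec a (Matrix.of f) t }
  -- H has the same leading monomial as β, hence the same product with t. The shifts are chosen so
  -- that, seen from the all-false corner, H vanishes at every corner except the all-true one.
  let H := shiftedMonomial (r := r) (n := n) (k := k) (fun t => (k : ℂ) - β 1 - t)
    (fun t => (k : ℂ) - t) β
  have hHval := shiftedMonomial_apply (r := r) (n := n) (k := k)
    (fun t => (k : ℂ) - β 1 - t) (fun t => (k : ℂ) - t) β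
  change ∀ x y, H x y = _ at hHval
  have hH : Λ H = 0 := by
    have h1 : Λ (H - monomialValue (johnsonCoord r n k) β) = 0 :=
      map_eq_zero_of_mem_span (fun γ hγ => hzero γ hγ)
        (shiftedMonomial_sub_mem MonomialOrder.degLex _ _ β)
    rw [map_sub, sub_eq_zero] at h1
    exact h1.trans h
  have hH' := congrFun hH (x fun _ => false)
  change (Matrix.of H).mulVec t (x fun _ => false) = 0 at hH'
  have hcast : ∀ u, ((equalNonzero (x fun _ => false).1 (x u).1 : ℂ) =
      k - ((∑ i, if u (Sum.inl i) then (1 : ℕ) else 0 : ℕ) : ℂ) -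
        ((∑ j, if u (Sum.inr j) then (1 : ℕ) else 0 : ℕ) : ℂ)) ∧
      (commonNonzero (x fun _ => false).1 (x u).1 : ℂ) =
      k - ((∑ j, if u (Sum.inr j) then (1 : ℕ) else 0 : ℕ) : ℂ) := by
    intro u
    have h1 := congrArg (Nat.cast (R := ℂ)) (he' u)
    have h2 := congrArg (Nat.cast (R := ℂ)) (hc' u)
    rw [Nat.cast_add, Nat.cast_add] at h1
    rw [Nat.cast_add] at h2
    exact ⟨by rw [← h1]; ring, by rw [← h2]; ring⟩
  have hlt : ∀ {q : ℕ} (w : Fin q → Bool) (j : Fin q), w j = false →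
      (∑ j, if w j then (1 : ℕ) else 0) < q := by
    intro q w j hj
    calc (∑ j, if w j then (1 : ℕ) else 0) < ∑ _j : Fin q, 1 :=
          Finset.sum_lt_sum (fun i _ => by split_ifs <;> simp) ⟨j, Finset.mem_univ _, by simp [hj]⟩
      _ = q := by simp
  rw [ht, Finset.sum_eq_single fun _ => true] at hH'
  · refine (mul_ne_zero (bitSign_ne_zero _) ?_) hH'
    rw [hHval, (hcast _).1, (hcast _).2]
    refine mul_ne_zero (Finset.prod_ne_zero_iff.2 fun s hs => ?_)
      (Finset.prod_ne_zero_iff.2 fun s hs => ?_)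
    · rw [Finset.mem_range] at hs
      simp only [if_true, Finset.sum_const, Finset.card_univ, Fintype.card_fin, smul_eq_mul,
        mul_one]
      intro h0
      have : (s : ℂ) = (β 0 : ℕ) := by linear_combination h0
      rw [Nat.cast_inj] at this
      omega
    · rw [Finset.mem_range] at hs
      simp only [if_true, Finset.sum_const, Finset.card_univ, Fintype.card_fin, smul_eq_mul,
        mul_one]
      intro h0
      have : (s : ℂ) = (β 1 : ℕ) := by linear_combination h0
      rw [Nat.cast_inj] at this
      omega
  · intro u _ hu
    refine mul_eq_zero_of_right _ ?_
    rw [hHval, (hcast _).1, (hcast _).2]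
    -- A missing moving bit makes a c-factor vanish. If all moving bits are set, e equals k - β 1
    -- minus the number of colour bits set, and a missing colour bit makes an e-factor vanish.
    by_cases hj : ∃ j, u (Sum.inr j) = false
    · obtain ⟨j, hj⟩ := hj
      exact mul_eq_zero_of_right _ (Finset.prod_eq_zero
        (Finset.mem_range.2 (hlt (fun j => u (Sum.inr j)) j hj)) (sub_self _))
    · have hi : ∃ i, u (Sum.inl i) = false := by
        by_contra! hi
        push Not at hj
        refine hu (funext fun s => ?_)
        rcases s with i | j
        · simpa using hi i
        · simpa using hj j
      obtain ⟨i, hi⟩ := hi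
      refine mul_eq_zero_of_left (Finset.prod_eq_zero
        (Finset.mem_range.2 (hlt (fun i => u (Sum.inl i)) i hi)) ?_) _
      have hj' : ∀ j, u (Sum.inr j) = true := by simpa using hj
      simp only [hj', if_true, Finset.sum_const, Finset.card_univ, Fintype.card_fin, smul_eq_mul,
        mul_one]
      ring
  · exact fun h => absurd (Finset.mem_univ _) h

/-- Opposite corners of the cube with sides α 0 and α 1 are in relation α. -/
theorem nonbinaryJohnson_surjective (hr : 2 < r) (hkn : k < n)
    (α : nonbinaryJohnsonDomain n k) : ∃ x y, nonbinaryJohnson r n k x y = α := by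
  have hα := α.2
  simp only [nonbinaryJohnsonDomain, Set.mem_ofPred_eq] at hα
  obtain ⟨x, -, -, he, hc⟩ := exists_cube (r := r) (a := α.1 0) (b := α.1 1) hr hkn hα.1
    (by omega)
  refine ⟨x fun _ => false, x fun _ => true, (nonbinaryJohnson_eq_iff _ _ _).2 ?_⟩
  have h1 := he fun _ => true
  have h2 := hc fun _ => true
  simp only [if_true, Finset.sum_const, Finset.card_univ, Fintype.card_fin, smul_eq_mul,
    mul_one] at h1 h2
  omega

theorem prod_erase_range_eq_ite {q s u : ℕ} (hu : u < q) :
    ∏ t ∈ (Finset.range q).erase s, ((u : ℂ) - t) =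
      if u = s then ∏ t ∈ (Finset.range q).erase s, ((s : ℂ) - t) else 0 := by
  split_ifs with h
  · rw [h]
  · exact Finset.prod_eq_zero (Finset.mem_erase.2 ⟨h, Finset.mem_range.2 hu⟩) (sub_self _)

theorem prod_erase_range_ne_zero (q s : ℕ) :
    ∏ t ∈ (Finset.range q).erase s, ((s : ℂ) - t) ≠ 0 := by
  refine Finset.prod_ne_zero_iff.2 fun t ht h => (Finset.mem_erase.1 ht).1 ?_
  exact_mod_cast (sub_eq_zero.1 h).symm

/-- The Bose-Mesner algebra consists of the polynomials in `e` and `c` with exponents in the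
domain. -/
theorem boseMesner_nonbinaryJohnson_eq (m : MonomialOrder (Fin 2)) :
    boseMesner (nonbinaryJohnson r n k) = Submodule.span ℂ
      ((fun α => Matrix.of (monomialValue (johnsonCoord r n k) α)) ''
        nonbinaryJohnsonDomain n k) := by
  refine le_antisymm (Submodule.span_le.2 ?_) (Submodule.span_le.2 ?_)
  · rintro _ ⟨α, rfl⟩
    -- Unnormalised Lagrange polynomials: e and c take values in {0, …, k}, so P 0 and P 1 pick out
    -- one value of each; the constant a below normalises their product.
    let P (i : Fin 2) (s : ℕ) : NonbinaryJohnsonPoint r n k → NonbinaryJohnsonPoint r n k → ℂ :=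
      ∏ t ∈ (Finset.range (k + 1)).erase s, (johnsonCoord r n k i - algebraMap ℂ _ (t : ℂ))
    have hP : ∀ i s, P i s ∈ Algebra.adjoin ℂ (Set.range (johnsonCoord r n k)) := fun i s =>
      Subalgebra.prod_mem _ fun t _ => Subalgebra.sub_mem _
        (Algebra.subset_adjoin ⟨i, rfl⟩) (Subalgebra.algebraMap_mem _ _)
    have hα : α.1 0 + α.1 1 ≤ k := α.2.1
    let a : ℂ := (∏ t ∈ (Finset.range (k + 1)).erase (k - α.1 0 - α.1 1),
        (((k - α.1 0 - α.1 1 : ℕ) : ℂ) - t)) *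
      ∏ t ∈ (Finset.range (k + 1)).erase (k - α.1 1), (((k - α.1 1 : ℕ) : ℂ) - t)
    have ha : a ≠ 0 := mul_ne_zero (prod_erase_range_ne_zero _ _) (prod_erase_range_ne_zero _ _)
    have hA : adjacencyMatrix (nonbinaryJohnson r n k) α =
        Matrix.of (a⁻¹ • (P 0 (k - α.1 0 - α.1 1) * P 1 (k - α.1 1))) := by
      ext x y
      have h1 := commonNonzero_le x y
      have h2 := equalNonzero_le_commonNonzero x.1 y.1
      have hP0 : P 0 (k - α.1 0 - α.1 1) x y = _ :=
        (show _ = ∏ t ∈ (Finset.range (k + 1)).erase (k - α.1 0 - α.1 1),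
          ((equalNonzero x.1 y.1 : ℂ) - t) by
          simp [P, johnsonCoord, Finset.prod_apply]).trans (prod_erase_range_eq_ite (by omega))
      have hP1 : P 1 (k - α.1 1) x y = _ :=
        (show _ = ∏ t ∈ (Finset.range (k + 1)).erase (k - α.1 1),
          ((commonNonzero x.1 y.1 : ℂ) - t) by
          simp [P, johnsonCoord, Finset.prod_apply]).trans (prod_erase_range_eq_ite (by omega))
      rw [adjacencyMatrix_apply, Matrix.of_apply]
      change _ = a⁻¹ * (P 0 (k - α.1 0 - α.1 1) x y * P 1 (k - α.1 1) x y)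
      rw [hP0, hP1]
      by_cases h : nonbinaryJohnson r n k x y = α
      · rw [if_pos h]
        rw [nonbinaryJohnson_eq_iff] at h
        rw [if_pos (by omega), if_pos (by omega)]
        exact (inv_mul_cancel₀ ha).symm
      · rw [if_neg h]
        rw [nonbinaryJohnson_eq_iff] at h
        by_cases h' : equalNonzero x.1 y.1 = k - α.1 0 - α.1 1
        · rw [if_neg (c := commonNonzero x.1 y.1 = k - α.1 1) (by omega), mul_zero, mul_zero]
        · rw [if_neg h', zero_mul, mul_zero]
    have hmem := mem_span_range_monomialValue_of_mem_adjoin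
      (Subalgebra.mul_mem _ (hP 0 (k - α.1 0 - α.1 1)) (hP 1 (k - α.1 1)))
    have hle : Submodule.span ℂ (Set.range (monomialValue (johnsonCoord r n k))) ≤
        Submodule.span ℂ (monomialValue (johnsonCoord r n k) '' nonbinaryJohnsonDomain n k) := by
      rw [Submodule.span_le]
      rintro _ ⟨γ, rfl⟩
      exact Submodule.span_mono (Set.image_mono Set.inter_subset_left)
        (monomialValue_mem_span_inter
          (fun γ hγ => monomialValue_johnsonCoord_mem_spanLT m hγ) γ)
    have := Submodule.mem_map_of_mem (f := (Matrix.ofLinearEquiv ℂ).toLinearMap)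
      (Submodule.smul_mem _ a⁻¹ (hle hmem))
    rw [Submodule.map_span, ← Set.image_comp] at this
    rw [hA]
    exact this
  · rintro _ ⟨α, -, rfl⟩
    refine mem_boseMesner_of_const fun x y x' y' h => ?_
    rw [nonbinaryJohnson_eq_nonbinaryJohnson_iff] at h
    change monomialValue (johnsonCoord r n k) α x y = monomialValue (johnsonCoord r n k) α x' y'
    rw [monomialValue_johnsonCoord_apply, monomialValue_johnsonCoord_apply, h.1, h.2]

end Coord

/-! ### The bivariate `Q`-polynomial structure -/

theorem finite_nonbinaryJohnsonDomain (n k : ℕ) : (nonbinaryJohnsonDomain n k).Finite := by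
  refine (Set.finite_Iic (Finsupp.equivFunOnFinite.symm fun _ : Fin 2 => k)).subset
    fun α hα i => ?_
  have h := hα.1
  rw [Finsupp.equivFunOnFinite_symm_apply_apply]
  fin_cases i
  · exact (Nat.le_add_right _ _).trans h
  · exact (Nat.le_add_left _ _).trans h

/-! ### Replacing e and c by other generators with the same leading exponents -/

section Labelling

variable {X : Type*} {l : ℕ} {m : MonomialOrder (Fin l)} {D : Set (Fin l →₀ ℕ)}
  {g h : Fin l → X → X → ℂ}

theorem spanLE_eq_of_leading (hh : ∀ i, h i ∈ spanLE m g (unitIndex i))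
    (hh' : ∀ i, h i ∉ spanLT m g (unitIndex i)) (α : Fin l →₀ ℕ) :
    spanLE m h α = spanLE m g α :=
  le_antisymm (spanLE_le_of_forall_mem hh α) (spanLE_le_of_forall_notMem hh hh' α)

theorem spanLT_eq_of_leading (hh : ∀ i, h i ∈ spanLE m g (unitIndex i))
    (hh' : ∀ i, h i ∉ spanLT m g (unitIndex i)) (α : Fin l →₀ ℕ) :
    spanLT m h α = spanLT m g α :=
  le_antisymm (spanLT_le_of_spanLE_le (spanLE_le_of_forall_mem hh) α)
    (spanLT_le_of_spanLE_le (spanLE_le_of_forall_notMem hh hh') α)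

/-- Relations outside D transfer to the new generators: the filtrations agree, and expanding over D
cannot use the exponent γ itself, so only strictly lower terms remain. -/
theorem monomialValue_mem_spanLT_of_leading
    (hD : ∀ γ ∉ D, monomialValue g γ ∈ spanLT m g γ)
    (hh : ∀ i, h i ∈ spanLE m g (unitIndex i)) (hh' : ∀ i, h i ∉ spanLT m g (unitIndex i))
    {γ : Fin l →₀ ℕ} (hγ : γ ∉ D) : monomialValue h γ ∈ spanLT m h γ := by
  have h1 : monomialValue h γ ∈ spanLE m g γ := by
    rw [← spanLE_eq_of_leading hh hh']
    exact monomialValue_mem_spanLE le_rfl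
  rw [spanLE_eq_span_inter hD] at h1
  rw [spanLT_eq_of_leading hh hh', spanLT_eq_span_inter hD]
  refine Submodule.span_mono (Set.image_mono ?_) h1
  rintro β hβ
  refine ⟨hβ.1, lt_of_le_of_ne hβ.2 fun h' => hγ ?_⟩
  rw [← m.toSyn.injective h']
  exact hβ.1

theorem hadamardMonomial_of (α : Fin l →₀ ℕ) :
    hadamardMonomial (fun i => Matrix.of (h i)) α = Matrix.of (monomialValue h α) := by
  ext x y
  simp [hadamardMonomial, monomialValue, Finset.prod_apply]

theorem hadamardEval_of_sum (s : Finset (Fin l →₀ ℕ)) (a : (Fin l →₀ ℕ) → ℂ) :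
    hadamardEval (fun i => Matrix.of (h i)) (∑ β ∈ s, MvPolynomial.monomial β (a β)) =
      Matrix.of (∑ β ∈ s, a β • monomialValue h β) := by
  ext x y
  simp [hadamardEval, MvPolynomial.eval_monomial, Finsupp.prod_fintype, monomialValue,
    Finset.prod_apply, Finset.sum_apply]

/-- An element with leading exponent `α` is the value of a polynomial of degree `α`. -/
theorem exists_polynomial_of_leading (hD : ∀ γ ∉ D, monomialValue h γ ∈ spanLT m h γ)
    {α : Fin l →₀ ℕ} {f : X → X → ℂ} (hf : f ∈ spanLE m h α) (hf' : f ∉ spanLT m h α) :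
    ∃ v : MvPolynomial (Fin l) ℂ, v ≠ 0 ∧ m.degree v = α ∧ (∀ β ∈ v.support, β ∈ D) ∧
      Matrix.of f = hadamardEval (fun i => Matrix.of (h i)) v := by
  classical
  rw [spanLE_eq_span_inter hD] at hf
  obtain ⟨a, ha, rfl⟩ := (Finsupp.mem_span_image_iff_linearCombination ℂ).1 hf
  rw [Finsupp.mem_supported] at ha
  have hα : α ∈ a.support := by
    by_contra hα
    refine hf' (Submodule.sum_mem _ fun β hβ => Submodule.smul_mem _ _
      (monomialValue_mem_spanLT ?_))
    refine lt_of_le_of_ne (Set.mem_ofPred.1 (ha hβ).2) fun h' => hα ?_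
    rwa [← m.toSyn.injective h']
  let v : MvPolynomial (Fin l) ℂ := ∑ β ∈ a.support, MvPolynomial.monomial β (a β)
  have hcoeff : ∀ β, v.coeff β = a β := by
    intro β
    simp only [v, MvPolynomial.coeff_sum, MvPolynomial.coeff_monomial]
    rw [Finset.sum_ite_eq' a.support β fun β => a β]
    split_ifs with hβ
    · rfl
    · exact (Finsupp.notMem_support_iff.1 hβ).symm
  have hsupp : ∀ β, β ∈ v.support ↔ β ∈ a.support := by
    intro β
    rw [MvPolynomial.mem_support_iff, hcoeff, Finsupp.mem_support_iff]
  refine ⟨v, fun h0 => ?_, m.toSyn.injective (le_antisymm ?_ ?_), fun β hβ => ?_, ?_⟩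
  · have := (hsupp α).2 hα
    rw [h0] at this
    simp at this
  · exact m.degree_le_iff.2 fun β hβ => (ha ((hsupp β).1 hβ)).2
  · exact m.le_degree ((hsupp α).2 hα)
  · exact (ha ((hsupp β).1 hβ)).1
  · rw [hadamardEval_of_sum]
    rfl

theorem hadamard_hadamardMonomial_mem (hD : ∀ γ ∉ D, monomialValue h γ ∈ spanLT m h γ)
    (i : Fin l) (α : Fin l →₀ ℕ) :
    Matrix.hadamard (Matrix.of (h i)) (hadamardMonomial (fun j => Matrix.of (h j)) α) ∈
      Submodule.span ℂ {M | ∃ β ∈ D, m.toSyn β ≤ m.toSyn (α + unitIndex i) ∧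
        M = hadamardMonomial (fun j => Matrix.of (h j)) β} := by
  have h1 := Submodule.mem_map_of_mem (f := (Matrix.ofLinearEquiv ℂ).toLinearMap)
    (monomialValue_mem_span_inter hD (α + unitIndex i))
  rw [Submodule.map_span] at h1
  have h2 : Matrix.hadamard (Matrix.of (h i)) (hadamardMonomial (fun j => Matrix.of (h j)) α) =
      Matrix.of (monomialValue h (α + unitIndex i)) := by
    rw [hadamardMonomial_of, monomialValue_add, monomialValue_unitIndex]
    ext x y
    exact mul_comm _ _
  rw [h2]
  refine Submodule.span_mono ?_ h1
  rintro _ ⟨_, ⟨β, hβ, rfl⟩, rfl⟩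
  exact ⟨β, hβ.1, hβ.2, (hadamardMonomial_of β).symm⟩

end Labelling

theorem unitIndex_mem_nonbinaryJohnsonDomain {n k : ℕ} (hk : 0 < k) (hkn : k < n) (i : Fin 2) :
    unitIndex i ∈ nonbinaryJohnsonDomain n k := by
  fin_cases i <;> simp [unitIndex, nonbinaryJohnsonDomain] <;> omega

/-- The primitive idempotents of the nonbinary Johnson scheme can be labelled by the domain, so
that the label is the leading exponent in `e` and `c`. -/
theorem exists_labelling_nonbinaryJohnson {r n k : ℕ} (hr : 2 < r) (hkn : k < n) :
    ∃ E : (Fin 2 →₀ ℕ) → NonbinaryJohnsonPoint r n k → NonbinaryJohnsonPoint r n k → ℂ,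
      Set.BijOn (fun α => Matrix.of (E α)) (nonbinaryJohnsonDomain n k)
        {F | IsPrimitiveIdempotent (boseMesner (nonbinaryJohnson r n k)) F} ∧
      ∀ α ∈ nonbinaryJohnsonDomain n k,
        E α ∈ spanLE MonomialOrder.degLex (johnsonCoord r n k) α ∧
        E α ∉ spanLT MonomialOrder.degLex (johnsonCoord r n k) α := by
  set m : MonomialOrder (Fin 2) := MonomialOrder.degLex with hm
  have hD : ∀ γ ∉ nonbinaryJohnsonDomain n k, monomialValue (johnsonCoord r n k) γ ∈
      spanLT m (johnsonCoord r n k) γ :=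
    fun γ hγ => monomialValue_johnsonCoord_mem_spanLT m hγ
  -- The index set is moved to `m.syn`, where the monomial order is a linear order. `Matrix.of`
  -- passes from functions, whose pointwise product is the Hadamard product, to matrices with the
  -- matrix product.
  let B : m.syn → Matrix (NonbinaryJohnsonPoint r n k) (NonbinaryJohnsonPoint r n k) ℂ :=
    fun s => Matrix.of (monomialValue (johnsonCoord r n k) (m.toSyn.symm s))
  have hBimage : ∀ p : Set m.syn, B '' (m.toSyn '' nonbinaryJohnsonDomain n k ∩ p) =
      (Matrix.ofLinearEquiv ℂ).toLinearMap '' (monomialValue (johnsonCoord r n k) ''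
        (nonbinaryJohnsonDomain n k ∩ {β | m.toSyn β ∈ p})) := by
    intro p
    ext M
    constructor
    · rintro ⟨_, ⟨⟨α, hα, rfl⟩, hp⟩, rfl⟩
      exact ⟨_, ⟨α, ⟨hα, hp⟩, rfl⟩, by simp [B]⟩
    · rintro ⟨_, ⟨α, ⟨hα, hp⟩, rfl⟩, rfl⟩
      exact ⟨m.toSyn α, ⟨⟨α, hα, rfl⟩, hp⟩, by simp [B]⟩
  choose! t ht0 ht1 using fun β hβ =>
    exists_testVector (r := r) (n := n) (k := k) hr hkn (β := β) hβ
  obtain ⟨E, hE, hE'⟩ := exists_idempotent_labelling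
    (𝔄 := boseMesner (nonbinaryJohnson r n k)) (D := m.toSyn '' nonbinaryJohnsonDomain n k)
    (B := B) (t := fun s => t (m.toSyn.symm s))
    ((finite_nonbinaryJohnsonDomain n k).image _)
    (by
      rw [boseMesner_nonbinaryJohnson_eq m, ← Set.image_comp]
      congr 1)
    (fun M hM N hN => mul_mem_boseMesner adjacencyMatrix_nonbinaryJohnson_mul_mem hM hN)
    (fun M hM N hN => mul_comm_of_mem_boseMesner nonbinaryJohnson_comm
      adjacencyMatrix_nonbinaryJohnson_mul_mem hM hN)
    (fun M hM => eq_zero_of_mul_self_eq_zero_of_mem_boseMesner nonbinaryJohnson_comm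
      adjacencyMatrix_nonbinaryJohnson_mul_mem hM)
    (by
      rintro _ ⟨α, hα, rfl⟩ _ ⟨β, hβ, rfl⟩ h
      simpa [B] using ht0 α hα β h)
    (by
      rintro _ ⟨α, hα, rfl⟩
      simpa [B] using ht1 α hα)
  refine ⟨fun α => Matrix.of.symm (E (m.toSyn α)), ?_, fun α hα => ?_⟩
  · exact hE.comp (m.toSyn.injective.injOn.bijOn_image)
  · have h := hE' _ ⟨α, hα, rfl⟩
    rw [hBimage, hBimage, ← Submodule.map_span, ← Submodule.map_span] at h
    rw [spanLE_eq_span_inter hD, spanLT_eq_span_inter hD]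
    refine ⟨?_, fun h' => h.2 ?_⟩
    · obtain ⟨f, hf, hfE⟩ := h.1
      change Matrix.of.symm (E (m.toSyn α)) ∈ _
      rw [← hfE]
      exact hf
    · exact ⟨_, h', rfl⟩

theorem theorem1p1 (r n k : ℕ) (hr : 2 < r) (hk : 0 < k) (hkn : k < n) :
    IsQPolynomialScheme (nonbinaryJohnson r n k) (nonbinaryJohnsonDomain n k)
      MonomialOrder.degLex := by
  have hsurj := nonbinaryJohnson_surjective (r := r) (n := n) (k := k) hr hkn
  have hunit := unitIndex_mem_nonbinaryJohnsonDomain hk hkn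
  refine ⟨isCommAssocScheme_nonbinaryJohnson hsurj, hunit, fun α hα β hβ => ?_, ?_⟩
  · have h0 := hβ 0
    have h1 := hβ 1
    simp only [nonbinaryJohnsonDomain, Set.mem_ofPred_eq] at hα ⊢
    omega
  obtain ⟨E, hE, hE'⟩ := exists_labelling_nonbinaryJohnson (r := r) (n := n) (k := k) hr hkn
  have hcard : (Fintype.card (NonbinaryJohnsonPoint r n k) : ℂ) ≠ 0 := by
    obtain ⟨x, -⟩ := hsurj ⟨_, hunit 0⟩
    have : Nonempty (NonbinaryJohnsonPoint r n k) := ⟨x⟩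
    exact Nat.cast_ne_zero.2 Fintype.card_ne_zero
  have hlead : ∀ a : ℂ, a ≠ 0 → ∀ α ∈ nonbinaryJohnsonDomain n k,
      a • E α ∈ spanLE MonomialOrder.degLex (johnsonCoord r n k) α ∧
        a • E α ∉ spanLT MonomialOrder.degLex (johnsonCoord r n k) α := fun a ha α hα =>
    ⟨Submodule.smul_mem _ _ (hE' α hα).1, fun h => (hE' α hα).2
      ((Submodule.smul_mem_iff _ ha).1 h)⟩
  refine ⟨fun α => Matrix.of (E α), hE, fun α hα => ?_, fun i α _ => ?_⟩
  · have hh := fun i => (hlead _ hcard _ (hunit i)).1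
    have hh' := fun i => (hlead _ hcard _ (hunit i)).2
    refine exists_polynomial_of_leading
      (h := fun i => (Fintype.card (NonbinaryJohnsonPoint r n k) : ℂ) • E (unitIndex i))
      (f := (Fintype.card (NonbinaryJohnsonPoint r n k) : ℂ) • E α)
      (fun γ hγ => monomialValue_mem_spanLT_of_leading
        (fun γ hγ => monomialValue_johnsonCoord_mem_spanLT _ hγ) hh hh' hγ) ?_ ?_
    · rw [spanLE_eq_of_leading hh hh']
      exact (hlead _ hcard α hα).1
    · rw [spanLT_eq_of_leading hh hh']
      exact (hlead _ hcard α hα).2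
  · exact hadamard_hadamardMonomial_mem (h := fun i => E (unitIndex i))
      (fun γ hγ => monomialValue_mem_spanLT_of_leading
        (fun γ hγ => monomialValue_johnsonCoord_mem_spanLT _ hγ)
        (fun i => (hE' _ (hunit i)).1) (fun i => (hE' _ (hunit i)).2) hγ) i α
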